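/- Let $n\ge 2$ be an integer. A Delzant polytope in $\mathbb{R}^n$ is a full-dimensional convex polytope $P\subset\mathbb{R}^n$ whose normal fan is unimodular, that is, the normal cone of every face of $P$ is generated by linearly independent primitive integer vectors $v_1,\dots,v_k$ that form a $\mathbb{Z}$-basis of $\operatorname{span}_{\mathbb{R}}(v_1,\dots,v_k)\cap\mathbb{Z}^n$. Let $\mathcal{D}(n)$ be the set of all Delzant polytopes in $\mathbb{R}^n$ and let $\mathcal{D}_f^m(n)\subset\mathcal{D}(n)$ be the set of those that have exactly $m$ facets. Both sets carry two distances: the Hausdorff distance $\delta^H$ and the symmetric difference distance $\delta^V(P,Q)=\operatorname{Vol}(P\setminus Q)+\operatorname{Vol}(Q\setminus P)$. Let $\operatorname{AGL}(n,\mathbb{Z})$ be the group of all maps $x\mapsto Ax+c$ with $A\in\operatorname{GL}(n,\mathbb{Z})$ and $c\in\mathbb{Z}^n$. Let $\widetilde{\mathcal{D}(n)}$ and $\widetilde{\mathcal{D}_f^m(n)}$ be the sets of $\operatorname{AGL}(n,\mathbb{Z})$-orbits in $\mathcal{D}(n)$ and in $\mathcal{D}_f^m(n)$, with the distance $\widetilde{\delta^V}([P],[Q])=\inf\{\delta^V(P',Q')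 : P'\in[P],\ Q'\in[Q]\}$, which is a metric. Then: (1) For every integer $m\ge n+1$, the Hausdorff dimension of $\mathcal{D}_f^m(n)$, with respect to $\delta^H$ as well as with respect to $\delta^V$, is exactly $m$, and the Hausdorff dimension of $\widetilde{\mathcal{D}_f^m(n)}$ with respect to $\widetilde{\delta^V}$ is exactly $m$. (2) The Hausdorff dimension of $\mathcal{D}(n)$, with respect to $\delta^H$ as well as with respect to $\delta^V$, is $\infty$, and the Hausdorff dimension of $\widetilde{\mathcal{D}(n)}$ with respect to $\widetilde{\delta^V}$ is $\infty$. -/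

import Mathlib

namespace Delzant

/-- The Euclidean space `ℝⁿ`; it is identified with its dual through the inner product. -/
abbrev Pt (n : ℕ) : Type := EuclideanSpace ℝ (Fin n)

/-- An integer vector, seen as a point of `ℝⁿ`. -/
noncomputable def intPt {n : ℕ} (v : Fin n → ℤ) : Pt n := WithLp.toLp 2 (fun i => (v i : ℝ))

/-! ### Polytopes, faces, normal fans -/

/-- A full-dimensional polytope: the convex hull of finitely many points, affinely spanning `ℝⁿ`. -/
def IsFullDimPolytope {n : ℕ} (P : Set (Pt n)) : Prop :=
  (∃ S : Finset (Pt n), P = convexHull ℝ (S : Set (Pt n))) ∧ affineSpan ℝ P = ⊤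

/-- The face `F_α(P)` of `P` in the direction of `α`: the points of `P` that maximize `α`. -/
def faceDir {n : ℕ} (P : Set (Pt n)) (α : Pt n) : Set (Pt n) :=
  {p | p ∈ P ∧ ∀ x ∈ P, inner ℝ α x ≤ inner ℝ α p}

/-- `F` is a face of `P`. (The polytope `P` is the face in the direction `0`; for a polytope, all
these faces are nonempty.) -/
def IsFace {n : ℕ} (P F : Set (Pt n)) : Prop := ∃ α : Pt n, F = faceDir P α

/-- A facet of a full-dimensional polytope in `ℝⁿ`: a face of dimension `n - 1`. -/
def IsFacet {n : ℕ} (P F : Set (Pt n)) : Prop :=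
  IsFace P F ∧ Module.finrank ℝ (vectorSpan ℝ F) + 1 = n

/-- The normal cone of a face `F` of `P`. -/
def normalCone {n : ℕ} (P F : Set (Pt n)) : Set (Pt n) := {α | F ⊆ faceDir P α}

/-- The normal fan of `P`: the collection of the normal cones of all faces of `P`. -/
def normalFan {n : ℕ} (P : Set (Pt n)) : Set (Set (Pt n)) :=
  {C | ∃ F, IsFace P F ∧ C = normalCone P F}

/-- The cone generated by finitely many vectors. -/
def coneGen {n k : ℕ} (v : Fin k → Pt n) : Set (Pt n) :=
  {x | ∃ a : Fin k → ℝ, (∀ i, 0 ≤ a i) ∧ x = ∑ i, a i • v i}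

/-- A unimodular cone: it is generated by linearly independent primitive integer vectors
`v₁, …, v_k` (so it is rational and simplicial), and the lattice generated by `v₁, …, v_k` is the
whole of `span_ℝ(v₁, …, v_k) ∩ ℤⁿ` (so its multiplicity, the index of the first lattice in the
second one, is one). -/
def IsUnimodularCone {n : ℕ} (C : Set (Pt n)) : Prop :=
  ∃ (k : ℕ) (v : Fin k → Fin n → ℤ),
    (∀ i, Finset.univ.gcd (v i) = 1) ∧
    LinearIndependent ℝ (fun i => intPt (v i)) ∧
    C = coneGen (fun i => intPt (v i)) ∧
    ∀ w : Fin n → ℤ, intPt w ∈ Submodule.span ℝ (Set.range fun i => intPt (v i)) →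
      w ∈ Submodule.span ℤ (Set.range v)

/-- A Delzant polytope in `ℝⁿ`: a full-dimensional polytope whose normal fan is unimodular. -/
def IsDelzant {n : ℕ} (P : Set (Pt n)) : Prop :=
  IsFullDimPolytope P ∧ ∀ C ∈ normalFan P, IsUnimodularCone C

/-- `P` has exactly `m` facets. -/
def HasFacets {n : ℕ} (P : Set (Pt n)) (m : ℕ) : Prop := {F | IsFacet P F}.encard = m

/-! ### Proper convex bodies with the symmetric difference distance -/

/-- Proper convex bodies: compact convex sets with nonempty interior. This is a new structure, so
that it does not inherit the Hausdorff distance that `ConvexBody` carries. -/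
@[ext]
structure ProperBody (n : ℕ) where
  /-- the underlying convex body -/
  body : ConvexBody (Pt n)
  interior_nonempty : (interior (body : Set (Pt n))).Nonempty

namespace ProperBody

variable {n : ℕ}

/-- The underlying set. -/
def toSet (P : ProperBody n) : Set (Pt n) := (P.body : Set (Pt n))

theorem toSet_injective : Function.Injective (toSet : ProperBody n → Set (Pt n)) := by
  intro P Q h
  exact ProperBody.ext (SetLike.coe_injective h)

theorem subset_of_volume_diff (P Q : ProperBody n)
    (h : MeasureTheory.volume (P.toSet \ Q.toSet) = 0) : P.toSet ⊆ Q.toSet := by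
  have hQ : IsClosed Q.toSet := Q.body.isClosed
  have h1 : interior P.toSet \ Q.toSet = ∅ := by
    have ho : IsOpen (interior P.toSet \ Q.toSet) := isOpen_interior.sdiff hQ
    by_contra hne
    have := ho.measure_pos MeasureTheory.volume (Set.nonempty_iff_ne_empty.2 hne)
    have h2 := MeasureTheory.measure_mono (μ := MeasureTheory.volume)
      (Set.sdiff_subset_sdiff_left (t := Q.toSet) (interior_subset (s := P.toSet)))
    rw [h] at h2
    exact absurd (lt_of_lt_of_le this h2) (lt_irrefl _)
  have h3 : closure (interior P.toSet) ⊆ Q.toSet :=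
    closure_minimal (Set.sdiff_eq_empty.1 h1) hQ
  have h4 : closure (interior P.toSet) = closure P.toSet :=
    P.body.convex.closure_interior_eq_closure_of_nonempty_interior P.interior_nonempty
  exact (subset_closure.trans h4.symm.subset).trans h3

/-- The symmetric difference distance `δ^V(P, Q) = Vol(P \ Q) + Vol(Q \ P)`. -/
noncomputable instance : EMetricSpace (ProperBody n) where
  edist P Q := MeasureTheory.volume (P.toSet \ Q.toSet) + MeasureTheory.volume (Q.toSet \ P.toSet)
  edist_self P := by simp
  edist_comm P Q := add_comm _ _
  edist_triangle P Q R := by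
    have key : ∀ A B C : Set (Pt n), MeasureTheory.volume (A \ C) ≤
        MeasureTheory.volume (A \ B) + MeasureTheory.volume (B \ C) := by
      intro A B C
      refine (MeasureTheory.measure_mono ?_).trans (MeasureTheory.measure_union_le _ _)
      intro x hx
      by_cases hB : x ∈ B
      · exact Or.inr ⟨hB, hx.2⟩
      · exact Or.inl ⟨hx.1, hB⟩
    calc _ ≤ (MeasureTheory.volume (P.toSet \ Q.toSet) + MeasureTheory.volume (Q.toSet \ R.toSet))
          + (MeasureTheory.volume (R.toSet \ Q.toSet) + MeasureTheory.volume (Q.toSet \ P.toSet)) :=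
          add_le_add (key _ _ _) (key _ _ _)
      _ = _ := by ring
  eq_of_edist_eq_zero := by
    intro P Q h
    have h' := add_eq_zero.1 h
    exact toSet_injective
      ((subset_of_volume_diff P Q h'.1).antisymm (subset_of_volume_diff Q P h'.2))

theorem edist_def (P Q : ProperBody n) : edist P Q =
    MeasureTheory.volume (P.toSet \ Q.toSet) + MeasureTheory.volume (Q.toSet \ P.toSet) := rfl

end ProperBody

/-! ### The group `AGL(n, ℤ)` and the quotient metric space -/

/-- The group `AGL(n, ℤ)` of the maps `x ↦ A x + c` with `A ∈ GL(n, ℤ)` and `c ∈ ℤⁿ`. -/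
def AGLZ (n : ℕ) : Subgroup (Pt n ≃ᵃ[ℝ] Pt n) where
  carrier := {g | ∃ (A : Matrix.GeneralLinearGroup (Fin n) ℤ) (c : Fin n → ℤ),
    ∀ x i, g x i = ∑ j, ((A : Matrix (Fin n) (Fin n) ℤ) i j : ℝ) * x j + (c i : ℝ)}
  one_mem' := by
    refine ⟨1, 0, fun x i => ?_⟩
    simp [Matrix.one_apply]
  mul_mem' := by
    rintro g h ⟨A, c, hg⟩ ⟨B, d, hh⟩
    refine ⟨A * B, fun i => ∑ j, (A : Matrix (Fin n) (Fin n) ℤ) i j * d j + c i, fun x i => ?_⟩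
    rw [AffineEquiv.mul_def, AffineEquiv.trans_apply, hg]
    simp only [hh, Units.val_mul, Matrix.mul_apply]
    push_cast
    simp only [mul_add, Finset.sum_add_distrib, Finset.mul_sum, Finset.sum_mul]
    rw [Finset.sum_comm, add_assoc]
    congr 1
    exact Finset.sum_congr rfl fun k _ => Finset.sum_congr rfl fun j _ => by ring
  inv_mem' := by
    rintro g ⟨A, c, hg⟩
    obtain ⟨B, hBA⟩ : ∃ B : Matrix.GeneralLinearGroup (Fin n) ℤ, B * A = 1 :=
      ⟨A⁻¹, inv_mul_cancel A⟩
    refine ⟨B, fun i => -∑ j, (B : Matrix (Fin n) (Fin n) ℤ) i j * c j, fun x i => ?_⟩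
    obtain ⟨y, rfl⟩ := g.surjective x
    have hinv : g⁻¹ (g y) = y := g.symm_apply_apply y
    have hB : ∀ i k, ∑ j, (((B : Matrix (Fin n) (Fin n) ℤ) i j : ℤ) : ℝ) *
        (((A : Matrix (Fin n) (Fin n) ℤ) j k : ℤ) : ℝ) = if i = k then 1 else 0 := by
      intro i k
      have h1 : ((B * A : Matrix.GeneralLinearGroup (Fin n) ℤ) : Matrix (Fin n) (Fin n) ℤ) i k
          = if i = k then 1 else 0 := by
        rw [hBA]; simp [Matrix.one_apply]
      rw [Units.val_mul, Matrix.mul_apply] at h1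
      exact_mod_cast h1
    rw [hinv]
    simp only [hg, mul_add, Finset.sum_add_distrib, Finset.mul_sum]
    push_cast
    rw [Finset.sum_comm, add_neg_cancel_right]
    simp only [← mul_assoc, ← Finset.sum_mul, hB]
    simp

namespace AGLZ

variable {n : ℕ}

theorem volume_image (g : AGLZ n) (s : Set (Pt n)) :
    MeasureTheory.volume ((g : Pt n ≃ᵃ[ℝ] Pt n) '' s) = MeasureTheory.volume s := by
  obtain ⟨g, A, c, hg⟩ := g
  change MeasureTheory.volume (g '' s) = _
  set L : Pt n →ₗ[ℝ] Pt n :=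
    Matrix.toLpLin 2 2 ((A : Matrix (Fin n) (Fin n) ℤ).map (Int.cast : ℤ → ℝ)) with hL
  have h1 : g '' s = (fun x => intPt c + x) '' (L '' s) := by
    rw [Set.image_image]
    refine Set.image_congr fun x _ => ?_
    ext i
    rw [hg]
    simp [hL, intPt, Matrix.toLpLin_apply, Matrix.mulVec, dotProduct, add_comm]
  have hdet : |LinearMap.det L| = 1 := by
    have h2 : LinearMap.det L = ((A : Matrix (Fin n) (Fin n) ℤ).det : ℝ) := by
      rw [hL, Matrix.toLpLin_eq_toLin, LinearMap.det_toLin]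
      exact (Int.cast_det _).symm
    have h3 : IsUnit (A : Matrix (Fin n) (Fin n) ℤ).det :=
      (Matrix.isUnit_iff_isUnit_det _).1 A.isUnit
    rw [h2]
    rcases Int.isUnit_iff.1 h3 with h | h <;> rw [h] <;> simp
  rw [h1, Set.image_add_left, MeasureTheory.measure_preimage_add,
    MeasureTheory.Measure.addHaar_image_linearMap, hdet]
  simp

/-- `AGL(n, ℤ)` acts on proper convex bodies by taking images. -/
noncomputable instance : MulAction (AGLZ n) (ProperBody n) where
  smul g P :=
    { body :=
        { carrier := (g : Pt n ≃ᵃ[ℝ] Pt n) '' P.toSet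
          convex' := P.body.convex.affine_image ((g : Pt n ≃ᵃ[ℝ] Pt n) : Pt n →ᵃ[ℝ] Pt n)
          isCompact' := P.body.isCompact.image (g : Pt n ≃ᵃ[ℝ] Pt n).continuous_of_finiteDimensional
          nonempty' := P.body.nonempty.image _ }
      interior_nonempty := by
        have hi : (g : Pt n ≃ᵃ[ℝ] Pt n) '' interior P.toSet =
            interior ((g : Pt n ≃ᵃ[ℝ] Pt n) '' P.toSet) :=
          (AffineEquiv.toContinuousAffineEquiv
            (g : Pt n ≃ᵃ[ℝ] Pt n)).toHomeomorph.image_interior P.toSet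
        change (interior ((g : Pt n ≃ᵃ[ℝ] Pt n) '' P.toSet)).Nonempty
        rw [← hi]
        exact P.interior_nonempty.image _ }
  one_smul P := ProperBody.toSet_injective (Set.image_id _)
  mul_smul g h P := ProperBody.toSet_injective (by
    change (fun x => (g : Pt n ≃ᵃ[ℝ] Pt n) ((h : Pt n ≃ᵃ[ℝ] Pt n) x)) '' P.toSet =
      (g : Pt n ≃ᵃ[ℝ] Pt n) '' ((h : Pt n ≃ᵃ[ℝ] Pt n) '' P.toSet)
    rw [Set.image_image])

theorem toSet_smul (g : AGLZ n) (P : ProperBody n) :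
    (g • P).toSet = (g : Pt n ≃ᵃ[ℝ] Pt n) '' P.toSet := rfl

theorem edist_smul (g : AGLZ n) (P Q : ProperBody n) : edist (g • P) (g • Q) = edist P Q := by
  simp only [ProperBody.edist_def, toSet_smul,
    ← Set.image_sdiff (g : Pt n ≃ᵃ[ℝ] Pt n).injective, volume_image]

/-- A proper convex body that is close to `P` contains a fixed ball. -/
theorem ball_subset_of_edist_lt {P Q : ProperBody n} {c : Pt n} {r : ℝ} (hr : 0 < r)
    (hP : Metric.closedBall c r ⊆ P.toSet)
    (h : edist P Q < MeasureTheory.volume (Metric.ball (0 : Pt n) (r / 4))) :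
    Metric.closedBall c (r / 2) ⊆ Q.toSet := by
  intro y hy
  by_contra hyQ
  obtain ⟨f, u, hfQ, hfy⟩ := geometric_hahn_banach_closed_point Q.body.convex Q.body.isClosed hyQ
  set a : Pt n := (InnerProductSpace.toDual ℝ (Pt n)).symm f with ha
  have hfa : ∀ x, f x = inner ℝ a x := fun x => by
    rw [ha, InnerProductSpace.toDual_symm_apply]
  have ha0 : a ≠ 0 := by
    intro h0
    obtain ⟨q, hq⟩ := Q.body.nonempty
    have h1 := hfQ q hq
    rw [hfa, h0, inner_zero_left] at h1 hfy
    linarith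
  have hna : 0 < ‖a‖ := norm_pos_iff.2 ha0
  set z : Pt n := y + (r / 4 / ‖a‖) • a with hz
  have hsub : Metric.ball z (r / 4) ⊆ P.toSet \ Q.toSet := by
    intro x hx
    rw [mem_ball_iff_norm] at hx
    constructor
    · apply hP
      rw [mem_closedBall_iff_norm] at hy ⊢
      have hzy : ‖(r / 4 / ‖a‖) • a‖ = r / 4 := by
        rw [norm_smul, Real.norm_of_nonneg (by positivity)]
        field_simp
      have hx' : x - c = (x - z) + (r / 4 / ‖a‖) • a + (y - c) := by rw [hz]; abel
      rw [hx']
      have h1 := norm_add₃_le (a := x - z) (b := (r / 4 / ‖a‖) • a) (c := y - c)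
      linarith
    · intro hxQ
      have h1 := hfQ x hxQ
      have hx' : x = (x - z) + (r / 4 / ‖a‖) • a + y := by rw [hz]; abel
      have h2 : f x = inner ℝ a (x - z) + (r / 4) * ‖a‖ + f y := by
        conv_lhs => rw [hx']
        rw [map_add, map_add, hfa, map_smul, hfa a, real_inner_self_eq_norm_sq, smul_eq_mul]
        field_simp
      have h3 := (abs_le.1 (abs_real_inner_le_norm a (x - z))).1
      have h4 : ‖a‖ * ‖x - z‖ ≤ ‖a‖ * (r / 4) := by gcongr
      nlinarith
  have hle : MeasureTheory.volume (Metric.ball (0 : Pt n) (r / 4)) ≤ edist P Q := by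
    rw [← MeasureTheory.Measure.addHaar_ball_center MeasureTheory.volume z (r / 4)]
    exact (MeasureTheory.measure_mono hsub).trans le_self_add
  exact absurd h (not_lt.2 hle)

/-- Only finitely many elements of `AGL(n, ℤ)` map a given ball into a given bounded set. -/
theorem finite_mapsTo (c : Pt n) {r : ℝ} (hr : 0 < r) (R : ℝ) :
    {g : AGLZ n | (g : Pt n ≃ᵃ[ℝ] Pt n) '' Metric.closedBall c r ⊆ Metric.closedBall 0 R}.Finite := by
  have hdata : ∀ g : AGLZ n, ∃ d : (Fin n → Fin n → ℤ) × (Fin n → ℤ),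
      ∀ x i, (g : Pt n ≃ᵃ[ℝ] Pt n) x i = ∑ j, (d.1 i j : ℝ) * x j + (d.2 i : ℝ) := by
    rintro ⟨g, A, c, hg⟩
    exact ⟨(fun i j => (A : Matrix (Fin n) (Fin n) ℤ) i j, c), hg⟩
  choose d hd using hdata
  have hinj : Function.Injective d := by
    intro g h hgh
    apply Subtype.ext
    ext x i
    rw [hd, hd, hgh]
  set M : ℤ := ⌈2 * R / r⌉ with hM
  set N : ℤ := ⌈R + ∑ j, (M : ℝ) * |c j|⌉ with hN
  have hfin : (Set.Icc (fun _ _ => -M : Fin n → Fin n → ℤ) (fun _ _ => M) ×ˢ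
      Set.Icc (fun _ => -N : Fin n → ℤ) (fun _ => N)).Finite :=
    (Set.finite_Icc _ _).prod (Set.finite_Icc _ _)
  refine (hfin.preimage (hinj.injOn (s := d ⁻¹' _))).subset ?_
  intro g hg
  have hcoord : ∀ x ∈ Metric.closedBall c r, ∀ i, |(g : Pt n ≃ᵃ[ℝ] Pt n) x i| ≤ R := by
    intro x hx i
    have h1 := hg (Set.mem_image_of_mem _ hx)
    rw [mem_closedBall_zero_iff] at h1
    exact (PiLp.norm_apply_le _ i).trans h1
  have hA : ∀ i j, |((d g).1 i j : ℝ)| ≤ M := by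
    intro i j
    have h1 := hcoord c (Metric.mem_closedBall_self hr.le) i
    have h2 := hcoord (c + EuclideanSpace.single j r) (by
      rw [mem_closedBall_iff_norm]; simp [abs_of_pos hr]) i
    have h3 : (g : Pt n ≃ᵃ[ℝ] Pt n) (c + EuclideanSpace.single j r) i =
        (g : Pt n ≃ᵃ[ℝ] Pt n) c i + ((d g).1 i j : ℝ) * r := by
      rw [hd, hd]
      simp [mul_add, Finset.sum_add_distrib]
      ring
    rw [h3] at h2
    have h4 : |((d g).1 i j : ℝ) * r| ≤ 2 * R := by
      rw [abs_le] at *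
      constructor <;> linarith [h1.1, h1.2, h2.1, h2.2]
    rw [abs_mul, abs_of_pos hr] at h4
    exact ((le_div_iff₀ hr).2 h4).trans (Int.le_ceil _)
  have hc : ∀ i, |((d g).2 i : ℝ)| ≤ N := by
    intro i
    have h1 := hcoord c (Metric.mem_closedBall_self hr.le) i
    have h2 : |∑ j, ((d g).1 i j : ℝ) * c j| ≤ ∑ j, (M : ℝ) * |c j| := by
      refine (Finset.abs_sum_le_sum_abs _ _).trans (Finset.sum_le_sum fun j _ => ?_)
      rw [abs_mul]
      exact mul_le_mul_of_nonneg_right (hA i j) (abs_nonneg _)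
    have h3 : ((d g).2 i : ℝ) = (g : Pt n ≃ᵃ[ℝ] Pt n) c i - ∑ j, ((d g).1 i j : ℝ) * c j := by
      rw [hd]; ring
    rw [h3]
    exact ((abs_sub _ _).trans (add_le_add h1 h2)).trans (Int.le_ceil _)
  have hA' : ∀ i j, |(d g).1 i j| ≤ M := fun i j => by exact_mod_cast hA i j
  have hc' : ∀ i, |(d g).2 i| ≤ N := fun i => by exact_mod_cast hc i
  exact ⟨⟨fun i j => (abs_le.1 (hA' i j)).1, fun i j => (abs_le.1 (hA' i j)).2⟩,
    ⟨fun i => (abs_le.1 (hc' i)).1, fun i => (abs_le.1 (hc' i)).2⟩⟩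

/-- If the orbit of `Q` comes arbitrarily close to `P`, then `P` is in the orbit. -/
theorem exists_smul_eq (P Q : ProperBody n) (h : ∀ ε > 0, ∃ g : AGLZ n, edist P (g • Q) < ε) :
    ∃ g : AGLZ n, P = g • Q := by
  obtain ⟨c, hc⟩ := P.interior_nonempty
  obtain ⟨r, hr, hrP⟩ := Metric.nhds_basis_closedBall.mem_iff.1 (mem_interior_iff_mem_nhds.1 hc)
  obtain ⟨R, hR⟩ := Q.body.isCompact.isBounded.subset_closedBall 0
  have hfin : {g : AGLZ n | edist P (g • Q) <
      MeasureTheory.volume (Metric.ball (0 : Pt n) (r / 4))}.Finite := by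
    refine ((finite_mapsTo c (half_pos hr) R).preimage (inv_injective.injOn)).subset ?_
    intro g hg
    have h1 := ball_subset_of_edist_lt hr hrP hg
    rintro _ ⟨x, hx, rfl⟩
    obtain ⟨q, hq, rfl⟩ := h1 hx
    have h2 : ((g⁻¹ : AGLZ n) : Pt n ≃ᵃ[ℝ] Pt n) ((g : Pt n ≃ᵃ[ℝ] Pt n) q) = q :=
      (g : Pt n ≃ᵃ[ℝ] Pt n).symm_apply_apply q
    rw [h2]
    exact hR hq
  have hv : 0 < MeasureTheory.volume (Metric.ball (0 : Pt n) (r / 4)) :=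
    Metric.measure_ball_pos _ _ (by positivity)
  obtain ⟨g₀, hg₀⟩ := h _ hv
  obtain ⟨g₁, hg₁, hmin⟩ := hfin.exists_minimalFor (fun g => edist P (g • Q)) _ ⟨g₀, hg₀⟩
  refine ⟨g₁, ?_⟩
  by_contra hne
  obtain ⟨g₂, hg₂⟩ := h _ (edist_pos.2 hne)
  exact absurd (hmin (hg₂.trans hg₁) hg₂.le) (not_le.2 hg₂)

end AGLZ

/-- The set of orbits of proper convex bodies under `AGL(n, ℤ)`. -/
def BodyOrbits (n : ℕ) : Type := MulAction.orbitRel.Quotient (AGLZ n) (ProperBody n)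

namespace BodyOrbits

variable {n : ℕ}

/-- The orbit of a proper convex body. -/
noncomputable def mk (P : ProperBody n) : BodyOrbits n :=
  Quotient.mk (MulAction.orbitRel (AGLZ n) (ProperBody n)) P

theorem exists_rep (x : BodyOrbits n) : ∃ P, mk P = x := Quotient.exists_rep x

theorem mk_eq_mk {P Q : ProperBody n} : mk P = mk Q ↔ ∃ g : AGLZ n, P = g • Q := by
  refine (Quotient.eq (r := MulAction.orbitRel (AGLZ n) (ProperBody n))).trans ?_
  rw [MulAction.orbitRel_apply, MulAction.mem_orbit_iff]
  exact ⟨fun ⟨g, hg⟩ => ⟨g, hg.symm⟩, fun ⟨g, hg⟩ => ⟨g, hg.symm⟩⟩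

/-- The distance between two orbits: the infimum of the distances between their elements. -/
noncomputable instance : EDist (BodyOrbits n) where
  edist x y := ⨅ (P : ProperBody n) (_ : mk P = x) (Q : ProperBody n) (_ : mk Q = y), edist P Q

theorem edist_def (x y : BodyOrbits n) : edist x y =
    ⨅ (P : ProperBody n) (_ : mk P = x) (Q : ProperBody n) (_ : mk Q = y), edist P Q := rfl

theorem edist_mk_le (P Q : ProperBody n) : edist (mk P) (mk Q) ≤ edist P Q :=
  iInf₂_le_of_le P rfl (iInf₂_le_of_le Q rfl le_rfl)

theorem exists_edist_lt {P : ProperBody n} {y : BodyOrbits n} {ε : ENNReal}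
    (h : edist (mk P) y < ε) : ∃ Q, mk Q = y ∧ edist P Q < ε := by
  simp only [edist_def, iInf_lt_iff] at h
  obtain ⟨P', hP', Q', rfl, hlt⟩ := h
  obtain ⟨g, rfl⟩ := mk_eq_mk.1 hP'.symm
  refine ⟨g • Q', mk_eq_mk.2 ⟨g, rfl⟩, ?_⟩
  rwa [AGLZ.edist_smul]

/-- The metric space of the orbits of proper convex bodies under `AGL(n, ℤ)`. -/
noncomputable instance : EMetricSpace (BodyOrbits n) where
  edist_self x := by
    obtain ⟨P, rfl⟩ := exists_rep x
    exact le_antisymm ((edist_mk_le P P).trans (edist_self P).le) (zero_le)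
  edist_comm x y := by
    have key : ∀ x y : BodyOrbits n, edist x y ≤ edist y x := by
      intro x y
      rw [edist_def y x]
      refine le_iInf₂ fun P hP => le_iInf₂ fun Q hQ => ?_
      subst hP hQ
      exact (edist_mk_le Q P).trans (edist_comm Q P).le
    exact (key x y).antisymm (key y x)
  edist_triangle x y z := by
    obtain ⟨P, rfl⟩ := exists_rep x
    refine ENNReal.le_of_forall_pos_le_add fun ε hε hfin => ?_
    have hε' : ((ε / 2 : NNReal) : ENNReal) ≠ 0 := by simpa using hε.ne'
    obtain ⟨h1, h2⟩ := ENNReal.add_lt_top.1 hfin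
    obtain ⟨Q, rfl, hQ⟩ := exists_edist_lt (ENNReal.lt_add_right h1.ne hε')
    obtain ⟨R, rfl, hR⟩ := exists_edist_lt (ENNReal.lt_add_right h2.ne hε')
    calc edist (mk P) (mk R) ≤ edist P R := edist_mk_le P R
      _ ≤ edist P Q + edist Q R := edist_triangle P Q R
      _ ≤ (edist (mk P) (mk Q) + (ε / 2 : NNReal)) + (edist (mk Q) (mk R) + (ε / 2 : NNReal)) :=
        add_le_add hQ.le hR.le
      _ = edist (mk P) (mk Q) + edist (mk Q) (mk R) + ((ε / 2 + ε / 2 : NNReal) : ENNReal) := by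
        push_cast; ring
      _ = _ := by rw [add_halves]
  eq_of_edist_eq_zero := by
    intro x y h
    obtain ⟨P, rfl⟩ := exists_rep x
    obtain ⟨Q, rfl⟩ := exists_rep y
    refine mk_eq_mk.2 (AGLZ.exists_smul_eq P Q fun ε hε => ?_)
    obtain ⟨Q', hQ', hlt⟩ := exists_edist_lt (h.trans_lt hε)
    obtain ⟨g, rfl⟩ := mk_eq_mk.1 hQ'
    exact ⟨g, hlt⟩

end BodyOrbits

/-! ### The spaces of Delzant polytopes -/

/-- The space of Delzant `n`-polytopes, inside the space of convex bodies in `ℝⁿ` with the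
Hausdorff distance. -/
def delzantH (n : ℕ) : Set (ConvexBody (Pt n)) := {P | IsDelzant (P : Set (Pt n))}

/-- The Delzant `n`-polytopes with `m` facets, with the Hausdorff distance. -/
def delzantFacetsH (n m : ℕ) : Set (ConvexBody (Pt n)) :=
  {P | IsDelzant (P : Set (Pt n)) ∧ HasFacets (P : Set (Pt n)) m}

/-- The space of Delzant `n`-polytopes, inside the space of proper convex bodies in `ℝⁿ` with the
symmetric difference distance. -/
def delzantV (n : ℕ) : Set (ProperBody n) := {P | IsDelzant P.toSet}

/-- The Delzant `n`-polytopes with `m` facets, with the symmetric difference distance. -/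
def delzantFacetsV (n m : ℕ) : Set (ProperBody n) := {P | IsDelzant P.toSet ∧ HasFacets P.toSet m}

/-- The quotient of the space of Delzant `n`-polytopes by `AGL(n, ℤ)`. -/
def delzantQuot (n : ℕ) : Set (BodyOrbits n) := BodyOrbits.mk '' delzantV n

/-- The quotient by `AGL(n, ℤ)` of the space of Delzant `n`-polytopes with `m` facets. -/
def delzantFacetsQuot (n m : ℕ) : Set (BodyOrbits n) := BodyOrbits.mk '' delzantFacetsV n m

end Delzant

/-!
A Delzant polytope with `m` facets is given by `m` integer normals and `m` right-hand sides. There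
are only countably many choices of the normals. For fixed normals, the polyhedron is a locally
Lipschitz function of its right-hand sides as long as it contains a ball of fixed radius and is
contained in another one, so the dimension is at most `m`.

Conversely, let a Delzant polytope be given with its `m` facets. Unimodularity at every point of the
polytope and irredundancy of the facet inequalities are open conditions on the right-hand sides.
Moving one right-hand side by `t` changes the volume over a small ball in the corresponding facet
in proportion to `t`, so close to the given polytope the right-hand sides are Lipschitz functions of
the polytope. Hence an open subset of `ℝᵐ` is a Lipschitz image of a set of polytopes, for both
distances. Stabilizers in `AGL(n, ℤ)` are finite and shrink under small perturbations; near a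
polytope whose stabilizer has minimal order, the distance of two orbits is the distance of the
polytopes themselves, which settles the quotient. A polytope to start with is obtained from a
simplex by repeatedly cutting off the vertex on the first coordinate axis.
-/

namespace Delzant

open MeasureTheory Metric Topology Filter Module
open scoped ENNReal NNReal

/-! ### Polyhedra and their dependence on the right-hand sides -/

section Polyhedron

variable {ι E : Type*} [NormedAddCommGroup E] [InnerProductSpace ℝ E] {w : ι → E} {h h' : ι → ℝ}
  {c : E} {r R δ : ℝ}

/-- The polyhedron with normals `w` and right-hand sides `h`, cut out by `⟨w i, x⟩ ≤ h i`. -/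
def polyhedron (w : ι → E) (h : ι → ℝ) : Set E := {x | ∀ i, inner ℝ (w i) x ≤ h i}

theorem convex_polyhedron : Convex ℝ (polyhedron w h) := by
  simp only [polyhedron, Set.ofPred_forall]
  exact convex_iInter fun i => convex_halfSpace_le (innerₗ E (w i)).isLinear _

theorem isClosed_polyhedron : IsClosed (polyhedron w h) := by
  simp only [polyhedron, Set.ofPred_forall]
  exact isClosed_iInter fun i => isClosed_le (by fun_prop) continuous_const

theorem polyhedron_mono (hle : h ≤ h') : polyhedron w h ⊆ polyhedron w h' :=
  fun _ hx i => (hx i).trans (hle i)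

theorem inner_add_mul_norm_le_of_closedBall_subset (hr : 0 ≤ r)
    (hc : closedBall c r ⊆ polyhedron w h) (i : ι) : inner ℝ (w i) c + r * ‖w i‖ ≤ h i := by
  rcases eq_or_ne (w i) 0 with hi | hi
  · simpa [hi] using hc (mem_closedBall_self hr) i
  have hpos : 0 < ‖w i‖ := norm_pos_iff.2 hi
  have hmem : c + (r / ‖w i‖) • w i ∈ closedBall c r := by
    rw [mem_closedBall_iff_norm, add_sub_cancel_left, norm_smul,
      Real.norm_of_nonneg (by positivity), div_mul_cancel₀ _ hpos.ne']
  calc inner ℝ (w i) c + r * ‖w i‖ = inner ℝ (w i) (c + (r / ‖w i‖) • w i) := by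
        rw [inner_add_right, real_inner_smul_right, real_inner_self_eq_norm_sq]
        field_simp
    _ ≤ h i := hc hmem i

theorem polyhedron_subset_homothety_image (hr : 0 < r) (hδ : 0 ≤ δ) (hw : ∀ i, 1 ≤ ‖w i‖)
    (hc : closedBall c r ⊆ polyhedron w h) (hle : ∀ i, h' i ≤ h i + δ) :
    polyhedron w h' ⊆ AffineMap.homothety c (1 + δ / r) '' polyhedron w h := by
  intro x hx
  have ht : 0 < 1 + δ / r := by positivity
  refine ⟨AffineMap.homothety c (1 + δ / r)⁻¹ x, fun i => ?_, ?_⟩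
  · have hslack : r ≤ h i - inner ℝ (w i) c := by
      have := inner_add_mul_norm_le_of_closedBall_subset hr.le hc i
      nlinarith [hw i]
    have hδ' : δ ≤ δ / r * (h i - inner ℝ (w i) c) :=
      calc δ = δ / r * r := (div_mul_cancel₀ δ hr.ne').symm
        _ ≤ _ := by gcongr
    have hscaled : (1 + δ / r)⁻¹ * (inner ℝ (w i) x - inner ℝ (w i) c)
        ≤ h i - inner ℝ (w i) c := by
      rw [inv_mul_le_iff₀ ht]
      linarith [hx i, hle i]
    rw [AffineMap.homothety_apply, vsub_eq_sub, vadd_eq_add, inner_add_right,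
      real_inner_smul_right, inner_sub_right]
    linarith
  · rw [← AffineMap.homothety_mul_apply, mul_inv_cancel₀ ht.ne', AffineMap.homothety_one,
      AffineMap.id_apply]

theorem exists_mem_polyhedron_dist_le (hr : 0 < r) (hδ : 0 ≤ δ) (hw : ∀ i, 1 ≤ ‖w i‖)
    (hc : closedBall c r ⊆ polyhedron w h) (hle : ∀ i, h' i ≤ h i + δ)
    (hR : polyhedron w h ⊆ closedBall 0 R) {x : E} (hx : x ∈ polyhedron w h') :
    ∃ y ∈ polyhedron w h, dist x y ≤ 2 * R / r * δ := by
  obtain ⟨y, hy, rfl⟩ := polyhedron_subset_homothety_image hr hδ hw hc hle hx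
  refine ⟨y, hy, ?_⟩
  have hyc : ‖y - c‖ ≤ 2 * R := by
    have hyR := mem_closedBall_zero_iff.1 (hR hy)
    have hcR := mem_closedBall_zero_iff.1 (hR (hc (mem_closedBall_self hr.le)))
    linarith [norm_sub_le y c]
  calc dist (AffineMap.homothety c (1 + δ / r) y) y = δ / r * ‖y - c‖ := by
        rw [AffineMap.homothety_apply, vsub_eq_sub, vadd_eq_add, dist_eq_norm, add_smul, one_smul,
          show y - c + (δ / r) • (y - c) + c - y = (δ / r) • (y - c) by abel, norm_smul,
          Real.norm_of_nonneg (by positivity)]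
    _ ≤ δ / r * (2 * R) := by gcongr
    _ = 2 * R / r * δ := by ring

theorem one_add_pow_sub_one_le {t : ℝ} (ht₀ : 0 ≤ t) (ht₁ : t ≤ 1) (n : ℕ) :
    (1 + t) ^ n - 1 ≤ (2 ^ n - 1) * t := by
  have hconv := (convexOn_pow n).2 (Set.mem_Ici.2 zero_le_one) (Set.mem_Ici.2 zero_le_two)
    (sub_nonneg.2 ht₁) ht₀ (sub_add_cancel 1 t)
  simp only [smul_eq_mul, one_pow, mul_one] at hconv
  rw [show 1 - t + t * 2 = 1 + t by ring] at hconv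
  linarith

theorem measure_polyhedron_sdiff_le [MeasurableSpace E] [BorelSpace E] [FiniteDimensional ℝ E]
    (μ : Measure E) [μ.IsAddHaarMeasure] (hr : 0 < r) (hδ : 0 ≤ δ) (hw : ∀ i, 1 ≤ ‖w i‖)
    (hc : closedBall c r ⊆ polyhedron w h) (hle : ∀ i, h' i ≤ h i + δ)
    (hR : polyhedron w h ⊆ closedBall 0 R) (hR' : polyhedron w h' ⊆ closedBall 0 R) :
    μ (polyhedron w h' \ polyhedron w h) ≤
      ENNReal.ofReal (2 ^ finrank ℝ E / r * δ) * μ (closedBall 0 R) := by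
  obtain ⟨t, rfl⟩ : ∃ t, δ = t * r := ⟨δ / r, (div_mul_cancel₀ δ hr.ne').symm⟩
  have ht : 0 ≤ t := nonneg_of_mul_nonneg_left hδ hr
  have hpow : (1 : ℝ) ≤ 2 ^ finrank ℝ E := one_le_pow₀ one_le_two
  rw [show 2 ^ finrank ℝ E / r * (t * r) = 2 ^ finrank ℝ E * t by field_simp]
  rcases le_total t 1 with ht₁ | ht₁
  · have hsub : ∀ {g : ι → ℝ}, (∀ i, g i ≤ h i + t * r) →
        polyhedron w g ⊆ AffineMap.homothety c (1 + t) '' polyhedron w h := fun hg => by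
      simpa only [mul_div_cancel_right₀ t hr.ne'] using
        polyhedron_subset_homothety_image hr hδ hw hc hg
    have hfin : μ (polyhedron w h) ≠ ∞ := ((measure_mono hR).trans_lt measure_closedBall_lt_top).ne
    calc μ (polyhedron w h' \ polyhedron w h)
        ≤ μ ((AffineMap.homothety c (1 + t) '' polyhedron w h) \ polyhedron w h) :=
          measure_mono (Set.sdiff_subset_sdiff_left (hsub hle))
      _ = ENNReal.ofReal ((1 + t) ^ finrank ℝ E) * μ (polyhedron w h) - μ (polyhedron w h) := by
          rw [measure_sdiff (hsub fun i => le_add_of_nonneg_right hδ)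
            isClosed_polyhedron.measurableSet.nullMeasurableSet hfin,
            Measure.addHaar_image_homothety, abs_of_nonneg (by positivity)]
      _ = ENNReal.ofReal ((1 + t) ^ finrank ℝ E - 1) * μ (polyhedron w h) := by
          rw [ENNReal.ofReal_sub _ zero_le_one, ENNReal.ofReal_one,
            ENNReal.sub_mul fun _ _ => hfin, one_mul]
      _ ≤ ENNReal.ofReal (2 ^ finrank ℝ E * t) * μ (closedBall 0 R) := by
          gcongr
          linarith [one_add_pow_sub_one_le ht ht₁ (finrank ℝ E)]
  · calc μ (polyhedron w h' \ polyhedron w h)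
        ≤ 1 * μ (closedBall 0 R) := by
          rw [one_mul]
          exact measure_mono (Set.sdiff_subset.trans hR')
      _ ≤ ENNReal.ofReal (2 ^ finrank ℝ E * t) * μ (closedBall 0 R) := by
          gcongr
          exact ENNReal.one_le_ofReal.2 (one_le_mul_of_one_le_of_one_le hpow ht₁)

end Polyhedron

/-! ### Bodies with given right-hand sides -/

section Polytope

variable {n : ℕ} {ι : Type*} {w : ι → Pt n} {h : ι → ℝ} {r R : ℝ}

instance : Nonempty (ProperBody n) :=
  ⟨⟨⟨closedBall 0 1, convex_closedBall 0 1, isCompact_closedBall 0 1,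
    nonempty_closedBall.2 zero_le_one⟩,
    ⟨0, ball_subset_interior_closedBall (mem_ball_self one_pos)⟩⟩⟩

/-- The polyhedron with normals `w` and right-hand sides `h` as a proper convex body. It is an
arbitrary body unless the polyhedron is bounded with nonempty interior. -/
noncomputable def polytope (w : ι → Pt n) (h : ι → ℝ) : ProperBody n :=
  Classical.epsilon fun P => P.toSet = polyhedron w h

theorem polytope_eq {P : ProperBody n} (hP : P.toSet = polyhedron w h) : polytope w h = P :=
  ProperBody.toSet_injective <| (Classical.epsilon_spec
    (p := fun Q : ProperBody n => Q.toSet = polyhedron w h) ⟨P, hP⟩).trans hP.symm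

theorem toSet_polytope (hint : (interior (polyhedron w h)).Nonempty)
    (hbdd : Bornology.IsBounded (polyhedron w h)) : (polytope w h).toSet = polyhedron w h := by
  let P : ProperBody n := ⟨⟨polyhedron w h, convex_polyhedron,
    isCompact_of_isClosed_isBounded isClosed_polyhedron hbdd, hint.mono interior_subset⟩, hint⟩
  rw [polytope_eq (P := P) rfl]
  rfl

/-- The right-hand sides of the polyhedra that contain a ball of radius `r` and are contained in
the ball of radius `R` around the origin. -/
def fatHeights (w : ι → Pt n) (r R : ℝ) : Set (ι → ℝ) :=
  {h | (∃ c, closedBall c r ⊆ polyhedron w h) ∧ polyhedron w h ⊆ closedBall 0 R}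

theorem toSet_polytope_of_mem_fatHeights (hr : 0 < r) (hh : h ∈ fatHeights w r R) :
    (polytope w h).toSet = polyhedron w h := by
  obtain ⟨⟨c, hc⟩, hR⟩ := hh
  exact toSet_polytope ⟨c, interior_mono hc (ball_subset_interior_closedBall (mem_ball_self hr))⟩
    (isBounded_closedBall.subset hR)

theorem le_add_dist_apply [Fintype ι] (h h' : ι → ℝ) (i : ι) : h' i ≤ h i + dist h h' := by
  have := dist_le_pi_dist h' h i
  rw [Real.dist_eq, dist_comm] at this
  linarith [le_abs_self (h' i - h i)]

theorem exists_lipschitzOnWith_body_polytope [Fintype ι] (hr : 0 < r) (hw : ∀ i, 1 ≤ ‖w i‖) :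
    ∃ K, LipschitzOnWith K (fun h => (polytope w h).body) (fatHeights w r R) := by
  refine ⟨(2 * R / r).toNNReal, LipschitzOnWith.of_dist_le' fun h hh h' hh' => ?_⟩
  have htoSet := toSet_polytope_of_mem_fatHeights hr hh
  have htoSet' := toSet_polytope_of_mem_fatHeights hr hh'
  obtain ⟨⟨⟨c, hc⟩, hR⟩, ⟨c', hc'⟩, hR'⟩ := And.intro hh hh'
  have hR₀ : 0 ≤ R := nonempty_closedBall.1 ⟨c, hR (hc (mem_closedBall_self hr.le))⟩
  rw [← ConvexBody.hausdorffDist_coe]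
  change hausdorffDist (polytope w h).toSet (polytope w h').toSet ≤ _
  rw [htoSet, htoSet']
  refine hausdorffDist_le_of_mem_dist (by positivity) (fun x hx => ?_) fun x hx => ?_
  · exact exists_mem_polyhedron_dist_le hr dist_nonneg hw hc'
      (fun i => dist_comm h' h ▸ le_add_dist_apply h' h i) hR' hx
  · exact exists_mem_polyhedron_dist_le hr dist_nonneg hw hc (le_add_dist_apply h h') hR hx

theorem exists_lipschitzOnWith_polytope [Fintype ι] (hr : 0 < r) (hw : ∀ i, 1 ≤ ‖w i‖) :
    ∃ K, LipschitzOnWith K (polytope w) (fatHeights w r R) := by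
  set V := volume (closedBall (0 : Pt n) R)
  refine ⟨2 * ((2 ^ finrank ℝ (Pt n) / r).toNNReal * V.toNNReal), fun h hh h' hh' => ?_⟩
  have htoSet := toSet_polytope_of_mem_fatHeights hr hh
  have htoSet' := toSet_polytope_of_mem_fatHeights hr hh'
  obtain ⟨⟨⟨c, hc⟩, hR⟩, ⟨c', hc'⟩, hR'⟩ := And.intro hh hh'
  have hV : (V.toNNReal : ℝ≥0∞) = V := ENNReal.coe_toNNReal measure_closedBall_lt_top.ne
  rw [ProperBody.edist_def, htoSet, htoSet']
  calc volume (polyhedron w h \ polyhedron w h') + volume (polyhedron w h' \ polyhedron w h)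
      ≤ ENNReal.ofReal (2 ^ finrank ℝ (Pt n) / r * dist h h') * V +
          ENNReal.ofReal (2 ^ finrank ℝ (Pt n) / r * dist h h') * V :=
        add_le_add
          (measure_polyhedron_sdiff_le volume hr dist_nonneg hw hc'
            (fun i => dist_comm h' h ▸ le_add_dist_apply h' h i) hR' hR)
          (measure_polyhedron_sdiff_le volume hr dist_nonneg hw hc (le_add_dist_apply h h') hR hR')
    _ = _ := by
        rw [edist_dist, ENNReal.ofReal_mul (by positivity)]
        push_cast
        rw [hV, ENNReal.ofReal]
        ring

end Polytope

/-! ### Dual systems and unimodular cones -/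

section Dual

variable {κ E : Type*} [NormedAddCommGroup E] [InnerProductSpace ℝ E] {w u : κ → E}

/-- The vectors `u i` are dual to the vectors `w i`, for `i ∈ I`. -/
def IsDualOn (w u : κ → E) (I : Set κ) : Prop :=
  (∀ i ∈ I, inner ℝ (u i) (w i) = 1) ∧ ∀ i ∈ I, ∀ j ∈ I, i ≠ j → inner ℝ (u i) (w j) = 0

theorem IsDualOn.mono {I J : Set κ} (hu : IsDualOn w u I) (hJ : J ⊆ I) : IsDualOn w u J :=
  ⟨fun i hi => hu.1 i (hJ hi), fun i hi j hj => hu.2 i (hJ hi) j (hJ hj)⟩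

theorem IsDualOn.inner_nonneg {I : Set κ} (hu : IsDualOn w u I) {i j : κ} (hi : i ∈ I)
    (hj : j ∈ I) : 0 ≤ inner ℝ (u i) (w j) := by
  rcases eq_or_ne i j with rfl | hij
  · exact (hu.1 i hi).symm ▸ zero_le_one
  · exact (hu.2 i hi j hj hij).ge

theorem IsDualOn.inner_sum_smul {s : Finset κ} (hu : IsDualOn w u s) {i : κ} (hi : i ∈ s)
    (a : κ → ℝ) : inner ℝ (u i) (∑ j ∈ s, a j • w j) = a i := by
  rw [inner_sum, Finset.sum_eq_single_of_mem i hi fun j hj hji => ?_, real_inner_smul_right,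
    hu.1 i hi, mul_one]
  rw [real_inner_smul_right, hu.2 i hi j hj hji.symm, mul_zero]

theorem IsDualOn.sum_inner_smul {s : Finset κ} (hu : IsDualOn w u s) {x : E}
    (hx : x ∈ Submodule.span ℝ (w '' s)) : ∑ i ∈ s, inner ℝ (u i) x • w i = x := by
  induction hx using Submodule.span_induction with
  | mem x hx =>
    obtain ⟨j, hj, rfl⟩ := hx
    rw [Finset.sum_eq_single_of_mem j hj fun i hi hij => by rw [hu.2 i hi j hj hij, zero_smul],
      hu.1 j hj, one_smul]
  | zero => simp
  | add x y _ _ hx hy => simp only [inner_add_right, add_smul, Finset.sum_add_distrib, hx, hy]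
  | smul c x _ hx => simp only [real_inner_smul_right, mul_smul, ← Finset.smul_sum, hx]

/-- The cone generated by the vectors `w i` with `i ∈ s`. -/
def coneGenOn (w : κ → E) (s : Finset κ) : Set E :=
  {x | ∃ a : κ → ℝ, (∀ i, 0 ≤ a i) ∧ x = ∑ i ∈ s, a i • w i}

end Dual

section IntPt

variable {n : ℕ} {κ : Type*}

theorem inner_intPt (v : Fin n → ℤ) (x : Pt n) : inner ℝ (intPt v) x = ∑ j, (v j : ℝ) * x j := by
  simp [intPt, PiLp.inner_apply, mul_comm]

theorem inner_intPt_intPt (u v : Fin n → ℤ) :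
    inner ℝ (intPt u) (intPt v) = ((u ⬝ᵥ v : ℤ) : ℝ) := by
  rw [inner_intPt]
  simp [intPt, dotProduct]

theorem intPt_injective : Function.Injective (intPt : (Fin n → ℤ) → Pt n) := fun u v huv => by
  ext j
  simpa [intPt] using congrArg (fun x : Pt n => x j) huv

theorem intPt_sum_smul (s : Finset κ) (a : κ → ℤ) (v : κ → Fin n → ℤ) :
    intPt (∑ i ∈ s, a i • v i) = ∑ i ∈ s, (a i : ℝ) • intPt (v i) := by
  ext j
  simp [intPt]

theorem one_le_norm_intPt {v : Fin n → ℤ} (hv : intPt v ≠ 0) : 1 ≤ ‖intPt v‖ := by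
  have hsq : 0 < ‖intPt v‖ ^ 2 := by positivity
  rw [← real_inner_self_eq_norm_sq, inner_intPt_intPt] at hsq
  rw [← one_le_sq_iff₀ (norm_nonneg _), ← real_inner_self_eq_norm_sq, inner_intPt_intPt]
  exact_mod_cast Int.cast_pos.1 hsq

theorem isDualOn_intPt_iff {v u : κ → Fin n → ℤ} {I : Set κ} :
    IsDualOn (fun i => intPt (v i)) (fun i => intPt (u i)) I ↔
      (∀ i ∈ I, u i ⬝ᵥ v i = 1) ∧ ∀ i ∈ I, ∀ j ∈ I, i ≠ j → u i ⬝ᵥ v j = 0 := by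
  simp only [IsDualOn, inner_intPt_intPt, Int.cast_eq_one, Int.cast_eq_zero]

theorem isUnimodularCone_coneGen {k : ℕ} {v u : Fin k → Fin n → ℤ}
    (hu : IsDualOn (fun i => intPt (v i)) (fun i => intPt (u i)) Set.univ) :
    IsUnimodularCone (coneGen fun i => intPt (v i)) := by
  have hcoeff (a : Fin k → ℝ) (i : Fin k) : inner ℝ (intPt (u i)) (∑ j, a j • intPt (v j)) = a i :=
    (hu.mono (Set.subset_univ _)).inner_sum_smul (Finset.mem_univ i) a
  refine ⟨k, v, fun i => ?_, ?_, rfl, fun w hw => ?_⟩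
  · have hdvd : Finset.univ.gcd (v i) ∣ 1 := by
      rw [← (isDualOn_intPt_iff.1 hu).1 i trivial]
      exact Finset.dvd_sum fun j _ => (Finset.gcd_dvd (Finset.mem_univ j)).mul_left _
    rw [← Finset.normalize_gcd, normalize_eq_one]
    exact isUnit_of_dvd_one hdvd
  · rw [Fintype.linearIndependent_iff]
    intro a ha i
    rw [← hcoeff a i, ha, inner_zero_right]
  · rw [Submodule.mem_span_range_iff_exists_fun] at hw ⊢
    obtain ⟨a, ha⟩ := hw
    refine ⟨fun i => u i ⬝ᵥ w, intPt_injective ?_⟩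
    rw [intPt_sum_smul, ← ha]
    refine Finset.sum_congr rfl fun i _ => ?_
    rw [← inner_intPt_intPt, ← ha, hcoeff]

theorem coneGenOn_eq_coneGen (w : κ → Pt n) (s : Finset κ) :
    coneGenOn w s = coneGen fun j => w (s.equivFin.symm j) := by
  classical
  have hsum (a : κ → ℝ) : ∑ i ∈ s, a i • w i =
      ∑ j, a (s.equivFin.symm j) • w (s.equivFin.symm j) := by
    rw [← Finset.sum_coe_sort s]
    exact (Equiv.sum_comp s.equivFin.symm (fun i : s => a i • w i)).symm
  ext x
  constructor
  · rintro ⟨a, ha, rfl⟩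
    exact ⟨fun j => a (s.equivFin.symm j), fun j => ha _, hsum a⟩
  · rintro ⟨a, ha, rfl⟩
    refine ⟨fun i => if hi : i ∈ s then a (s.equivFin ⟨i, hi⟩) else 0, fun i => ?_, ?_⟩
    · dsimp only
      split_ifs
      exacts [ha _, le_rfl]
    · rw [hsum]
      simp

theorem isUnimodularCone_coneGenOn {v u : κ → Fin n → ℤ} {s : Finset κ}
    (hu : IsDualOn (fun i => intPt (v i)) (fun i => intPt (u i)) s) :
    IsUnimodularCone (coneGenOn (fun i => intPt (v i)) s) := by
  rw [coneGenOn_eq_coneGen]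
  exact isUnimodularCone_coneGen (u := fun j => u (s.equivFin.symm j))
    ⟨fun j _ => hu.1 _ (s.equivFin.symm j).2, fun i _ j _ hij =>
      hu.2 _ (s.equivFin.symm i).2 _ (s.equivFin.symm j).2 fun heq =>
        hij (s.equivFin.symm.injective (Subtype.ext heq))⟩

end IntPt

/-! ### Active constraints and normal cones -/

section Active

variable {ι E : Type*} [Fintype ι] [NormedAddCommGroup E] [InnerProductSpace ℝ E] {w : ι → E}
  {h : ι → ℝ}

open Classical in
/-- The constraints of a polyhedron that hold with equality at `x`. -/
noncomputable def active (w : ι → E) (h : ι → ℝ) (x : E) : Finset ι :=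
  Finset.univ.filter fun i => inner ℝ (w i) x = h i

@[simp]
theorem mem_active {x : E} {i : ι} : i ∈ active w h x ↔ inner ℝ (w i) x = h i := by
  simp [active]

/-- At every point of the polyhedron the active normals have a dual system. For a bounded
polyhedron with nonempty interior and no redundant constraint this is simplicity. -/
def IsSimple (w : ι → E) (h : ι → ℝ) : Prop :=
  ∀ x ∈ polyhedron w h, ∃ u, IsDualOn w u (active w h x)

theorem exists_pos_add_smul_mem_polyhedron {x d : E} (hx : x ∈ polyhedron w h)
    (hd : ∀ i ∈ active w h x, inner ℝ (w i) d ≤ 0) :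
    ∃ ε > (0 : ℝ), x + ε • d ∈ polyhedron w h := by
  have hfeasible : ∀ᶠ ε in 𝓝[>] (0 : ℝ), ∀ i, inner ℝ (w i) (x + ε • d) ≤ h i := by
    refine eventually_all.2 fun i => ?_
    by_cases hi : i ∈ active w h x
    · filter_upwards [self_mem_nhdsWithin] with ε hε
      rw [inner_add_right, real_inner_smul_right, mem_active.1 hi]
      linarith [mul_nonpos_of_nonneg_of_nonpos (le_of_lt hε) (hd i hi)]
    · have hlt : inner ℝ (w i) (x + (0 : ℝ) • d) < h i := by
        rw [zero_smul, add_zero]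
        exact lt_of_le_of_ne (hx i) fun heq => hi (mem_active.2 heq)
      have hcont : Continuous fun ε : ℝ => inner ℝ (w i) (x + ε • d) := by fun_prop
      exact (((hcont.tendsto 0).eventually_lt_const hlt).filter_mono nhdsWithin_le_nhds).mono
        fun _ => le_of_lt
  obtain ⟨ε, hmem, hε⟩ := (hfeasible.and self_mem_nhdsWithin).exists
  exact ⟨ε, hε, hmem⟩

theorem inner_nonpos_of_forall_inner_le {x d α : E} (hx : x ∈ polyhedron w h)
    (hα : ∀ y ∈ polyhedron w h, inner ℝ α y ≤ inner ℝ α x)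
    (hd : ∀ i ∈ active w h x, inner ℝ (w i) d ≤ 0) : inner ℝ α d ≤ 0 := by
  obtain ⟨ε, hε, hmem⟩ := exists_pos_add_smul_mem_polyhedron hx hd
  have hle := hα _ hmem
  rw [inner_add_right, real_inner_smul_right] at hle
  nlinarith

theorem mem_span_active_of_forall_inner_le {x α : E} (hx : x ∈ polyhedron w h)
    (hα : ∀ y ∈ polyhedron w h, inner ℝ α y ≤ inner ℝ α x) :
    α ∈ Submodule.span ℝ (w '' active w h x) := by
  have : FiniteDimensional ℝ (Submodule.span ℝ (w '' active w h x)) :=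
    FiniteDimensional.span_of_finite ℝ (Set.toFinite _)
  rw [← Submodule.orthogonal_orthogonal (Submodule.span ℝ (w '' active w h x)),
    Submodule.mem_orthogonal']
  intro d hd
  have hwd : ∀ i ∈ active w h x, inner ℝ (w i) d = 0 := fun i hi =>
    (Submodule.mem_orthogonal _ d).1 hd _ (Submodule.subset_span ⟨i, hi, rfl⟩)
  have hneg := inner_nonpos_of_forall_inner_le (d := -d) hx hα fun i hi => by
    rw [inner_neg_right, hwd i hi, neg_zero]
  rw [inner_neg_right] at hneg
  exact le_antisymm (inner_nonpos_of_forall_inner_le hx hα fun i hi => (hwd i hi).le) (by linarith)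

theorem mem_coneGenOn_active_of_forall_inner_le {u : ι → E} {x α : E}
    (hu : IsDualOn w u (active w h x)) (hx : x ∈ polyhedron w h)
    (hα : ∀ y ∈ polyhedron w h, inner ℝ α y ≤ inner ℝ α x) :
    α ∈ coneGenOn w (active w h x) := by
  have hα_nonneg : ∀ i ∈ active w h x, 0 ≤ inner ℝ (u i) α := fun i hi => by
    have hneg := inner_nonpos_of_forall_inner_le (d := -u i) hx hα fun j hj => by
      rw [inner_neg_right, real_inner_comm, neg_nonpos]
      exact hu.inner_nonneg hi hj
    rw [inner_neg_right, real_inner_comm] at hneg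
    linarith
  refine ⟨fun i => |inner ℝ (u i) α|, fun i => abs_nonneg _,
    (hu.sum_inner_smul (mem_span_active_of_forall_inner_le hx hα)).symm.trans ?_⟩
  exact Finset.sum_congr rfl fun i hi => congrArg (· • w i) (abs_of_nonneg (hα_nonneg i hi)).symm

/- The midpoint of two points of a polyhedron has no active constraint besides the common ones. -/
theorem exists_forall_active_subset {F : Set E} (hF : Convex ℝ F) (hne : F.Nonempty)
    (hsub : F ⊆ polyhedron w h) : ∃ x ∈ F, ∀ y ∈ F, active w h x ⊆ active w h y := by
  obtain ⟨x, hx, hmin⟩ := exists_minimalFor_of_wellFoundedLT (· ∈ F)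
    (fun x => (active w h x).card) hne
  refine ⟨x, hx, fun y hy => ?_⟩
  have hmidF : midpoint ℝ x y ∈ F := hF.midpoint_mem hx hy
  have hmid : ∀ i ∈ active w h (midpoint ℝ x y), i ∈ active w h x ∧ i ∈ active w h y := by
    intro i hi
    rw [mem_active, midpoint_eq_smul_add, real_inner_smul_right, inner_add_right, invOf_eq_inv]
      at hi
    rw [mem_active, mem_active]
    constructor <;> linarith [hsub hx i, hsub hy i]
  have hmid_eq : active w h (midpoint ℝ x y) = active w h x :=
    Finset.eq_of_subset_of_card_le (fun i hi => (hmid i hi).1) <| by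
      by_contra! hlt
      exact absurd (hmin hmidF hlt.le) (not_le.2 hlt)
  exact fun i hi => (hmid i (hmid_eq ▸ hi)).2

theorem eq_of_mem_extremePoints_of_active_eq {x y : E}
    (hx : x ∈ (polyhedron w h).extremePoints ℝ) (hy : y ∈ polyhedron w h)
    (hxy : active w h x = active w h y) : y = x := by
  obtain ⟨ε, hε, hmem⟩ := exists_pos_add_smul_mem_polyhedron (d := x - y) hx.1 fun i hi => by
    rw [inner_sub_right, mem_active.1 hi, mem_active.1 (hxy ▸ hi), sub_self]
  refine ((mem_extremePoints.1 hx).2 _ hmem _ hy ?_).2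
  have hpos : 0 < 1 + ε := by positivity
  refine ⟨(1 + ε)⁻¹, ε * (1 + ε)⁻¹, by positivity, by positivity, by field_simp, ?_⟩
  rw [mul_comm ε, mul_smul, ← smul_add, inv_smul_eq_iff₀ hpos.ne']
  module

end Active

theorem finite_extremePoints_polyhedron {ι E : Type*} [Finite ι] [NormedAddCommGroup E]
    [InnerProductSpace ℝ E] {w : ι → E} {h : ι → ℝ} :
    ((polyhedron w h).extremePoints ℝ).Finite := by
  have := Fintype.ofFinite ι
  exact Set.Finite.of_finite_image (Set.toFinite (active w h '' _)) fun _ hx _ hy hxy =>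
    (eq_of_mem_extremePoints_of_active_eq hx hy.1 hxy).symm

section Face

variable {n : ℕ}

theorem faceDir_nonempty {P : Set (Pt n)} (hP : IsCompact P) (hne : P.Nonempty) (α : Pt n) :
    (faceDir P α).Nonempty := by
  obtain ⟨x, hx, hmax⟩ := hP.exists_isMaxOn hne (f := fun x => inner ℝ α x) (by fun_prop)
  exact ⟨x, hx, fun y hy => hmax hy⟩

theorem convex_faceDir {P : Set (Pt n)} (hP : Convex ℝ P) (α : Pt n) :
    Convex ℝ (faceDir P α) := by
  intro x hx y hy a b ha hb hab
  refine ⟨hP hx.1 hy.1 ha hb hab, fun z hz => ?_⟩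
  rw [inner_add_right, real_inner_smul_right, real_inner_smul_right]
  calc inner ℝ α z = a * inner ℝ α z + b * inner ℝ α z := by rw [← add_mul, hab, one_mul]
    _ ≤ a * inner ℝ α x + b * inner ℝ α y := by
      gcongr
      exacts [hx.2 z hz, hy.2 z hz]

end Face

section NormalFan

variable {n : ℕ} {ι : Type*} {w : ι → Pt n} {v : ι → Fin n → ℤ} {h : ι → ℝ}

theorem isFullDimPolytope_polyhedron [Finite ι]
    (hbdd : Bornology.IsBounded (polyhedron w h))
    (hint : (interior (polyhedron w h)).Nonempty) : IsFullDimPolytope (polyhedron w h) := by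
  have hcompact := isCompact_of_isClosed_isBounded isClosed_polyhedron hbdd
  refine ⟨⟨(finite_extremePoints_polyhedron (w := w) (h := h)).toFinset, ?_⟩, ?_⟩
  · rw [Set.Finite.coe_toFinset]
    conv_lhs => rw [← closure_convexHull_extremePoints hcompact convex_polyhedron]
    exact (finite_extremePoints_polyhedron.isClosed_convexHull ℝ).closure_eq
  · exact top_le_iff.1 ((isOpen_interior.affineSpan_eq_top hint).ge.trans
      (affineSpan_mono ℝ interior_subset))

variable [Fintype ι]

theorem normalCone_faceDir_polyhedron {u : ι → Pt n} {α x : Pt n}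
    (hu : IsDualOn w u (active w h x)) (hx : x ∈ faceDir (polyhedron w h) α)
    (hmin : ∀ y ∈ faceDir (polyhedron w h) α, active w h x ⊆ active w h y) :
    normalCone (polyhedron w h) (faceDir (polyhedron w h) α) = coneGenOn w (active w h x) := by
  refine Set.Subset.antisymm
    (fun β hβ => mem_coneGenOn_active_of_forall_inner_le hu hx.1 (hβ hx).2) ?_
  rintro _ ⟨a, ha, rfl⟩ y hy
  refine ⟨hy.1, fun z hz => ?_⟩
  simp only [sum_inner, real_inner_smul_left]
  gcongr with i hi
  · exact ha i
  · exact (hz i).trans_eq (mem_active.1 (hmin y hy hi)).symm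

/-- At every point of the polyhedron the active normals have an integer dual system. -/
def IsSmooth (v : ι → Fin n → ℤ) (h : ι → ℝ) : Prop :=
  ∀ x ∈ polyhedron (fun i => intPt (v i)) h, ∃ u : ι → Fin n → ℤ,
    IsDualOn (fun i => intPt (v i)) (fun i => intPt (u i)) (active (fun i => intPt (v i)) h x)

theorem IsSmooth.isSimple (hs : IsSmooth v h) : IsSimple (fun i => intPt (v i)) h := fun x hx =>
  let ⟨u, hu⟩ := hs x hx
  ⟨fun i => intPt (u i), hu⟩

theorem IsSmooth.isDelzant (hs : IsSmooth v h)
    (hbdd : Bornology.IsBounded (polyhedron (fun i => intPt (v i)) h))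
    (hint : (interior (polyhedron (fun i => intPt (v i)) h)).Nonempty) :
    IsDelzant (polyhedron (fun i => intPt (v i)) h) := by
  refine ⟨isFullDimPolytope_polyhedron hbdd hint, ?_⟩
  rintro _ ⟨_, ⟨α, rfl⟩, rfl⟩
  have hcompact := isCompact_of_isClosed_isBounded isClosed_polyhedron hbdd
  obtain ⟨x, hx, hmin⟩ := exists_forall_active_subset (convex_faceDir convex_polyhedron α)
    (faceDir_nonempty hcompact (hint.mono interior_subset) α) fun _ hy => hy.1
  obtain ⟨u, hu⟩ := hs x hx.1
  rw [normalCone_faceDir_polyhedron hu hx hmin]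
  exact isUnimodularCone_coneGenOn hu

end NormalFan

/-! ### Facets -/

section Hyperplane

variable {E : Type*} [NormedAddCommGroup E] [InnerProductSpace ℝ E]

theorem mem_orthogonal_vectorSpan {F : Set E} {α : E} {c : ℝ} (hF : ∀ x ∈ F, inner ℝ α x = c) :
    α ∈ (vectorSpan ℝ F)ᗮ := by
  suffices h : vectorSpan ℝ F ≤ (ℝ ∙ α)ᗮ from fun v hv =>
    Submodule.mem_orthogonal_singleton_iff_inner_left.1 (h hv)
  rw [vectorSpan_def, Submodule.span_le]
  rintro _ ⟨x, hx, y, hy, rfl⟩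
  rw [SetLike.mem_coe, Submodule.mem_orthogonal_singleton_iff_inner_right]
  change inner ℝ α (x - y) = 0
  rw [inner_sub_right, hF x hx, hF y hy, sub_self]

theorem inner_eq_of_mem_orthogonal_vectorSpan {F : Set E} {α x y : E}
    (hα : α ∈ (vectorSpan ℝ F)ᗮ) (hx : x ∈ F) (hy : y ∈ F) : inner ℝ α x = inner ℝ α y := by
  rw [← sub_eq_zero, ← inner_sub_right]
  exact Submodule.inner_left_of_mem_orthogonal (vsub_mem_vectorSpan ℝ hx hy) hα

theorem finrank_orthogonal_span_singleton_add_one [FiniteDimensional ℝ E] {α : E} (hα : α ≠ 0) :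
    finrank ℝ (ℝ ∙ α)ᗮ + 1 = finrank ℝ E := by
  rw [← Submodule.finrank_add_finrank_orthogonal (ℝ ∙ α), finrank_span_singleton hα, add_comm]

end Hyperplane

section Facet

variable {n : ℕ} {P F : Set (Pt n)} {α β : Pt n}

theorem faceDir_smul {a : ℝ} (ha : 0 < a) (α : Pt n) : faceDir P (a • α) = faceDir P α := by
  ext x
  simp only [faceDir, Set.mem_ofPred_eq, real_inner_smul_left, mul_le_mul_iff_right₀ ha]

theorem faceDir_zero : faceDir P 0 = P := by
  ext x
  simp [faceDir]

theorem ne_zero_of_isFacet_faceDir (hP : affineSpan ℝ P = ⊤) (hF : IsFacet P (faceDir P α)) :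
    α ≠ 0 := by
  rintro rfl
  have hdim := hF.2
  rw [faceDir_zero, ← direction_affineSpan, hP, AffineSubspace.direction_top, finrank_top,
    finrank_euclideanSpace, Fintype.card_fin] at hdim
  omega

theorem mem_orthogonal_vectorSpan_of_mem_normalCone (hα : α ∈ normalCone P F) :
    α ∈ (vectorSpan ℝ F)ᗮ := by
  rcases F.eq_empty_or_nonempty with rfl | ⟨x, hx⟩
  · simp
  · exact mem_orthogonal_vectorSpan fun y hy =>
      le_antisymm ((hα hx).2 y (hα hy).1) ((hα hy).2 x (hα hx).1)

theorem IsFacet.exists_smul_eq (hF : IsFacet P F) (hα : α ∈ (vectorSpan ℝ F)ᗮ)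
    (hβ : β ∈ (vectorSpan ℝ F)ᗮ) (hα₀ : α ≠ 0) : ∃ c : ℝ, c • α = β := by
  have hdim : finrank ℝ (vectorSpan ℝ F)ᗮ = 1 := by
    have hadd := Submodule.finrank_add_finrank_orthogonal (vectorSpan ℝ F)
    have hfacet := hF.2
    rw [finrank_euclideanSpace, Fintype.card_fin] at hadd
    omega
  obtain ⟨c, hc⟩ := (finrank_eq_one_iff_of_nonzero' (⟨α, hα⟩ : (vectorSpan ℝ F)ᗮ)
    (by simpa using hα₀)).1 hdim ⟨β, hβ⟩
  exact ⟨c, congrArg Subtype.val hc⟩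

end Facet

section Irredundant

variable {ι E : Type*} [NormedAddCommGroup E] [InnerProductSpace ℝ E] {w : ι → E} {h : ι → ℝ}

/-- Every constraint is the only active one at some point of the polyhedron. -/
def IsIrredundant (w : ι → E) (h : ι → ℝ) : Prop :=
  ∀ i, ∃ p : E, inner ℝ (w i) p = h i ∧ ∀ j, j ≠ i → inner ℝ (w j) p < h j

theorem mem_polyhedron_of_forall_ne_inner_lt {i : ι} {p : E} (hp : inner ℝ (w i) p = h i)
    (hlt : ∀ j, j ≠ i → inner ℝ (w j) p < h j) : p ∈ polyhedron w h := fun j => by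
  rcases eq_or_ne j i with rfl | hj
  exacts [hp.le, (hlt j hj).le]

theorem IsSimple.ne_zero [Fintype ι] (hs : IsSimple w h) (hirr : IsIrredundant w h) (i : ι) :
    w i ≠ 0 := by
  obtain ⟨p, hp, hlt⟩ := hirr i
  obtain ⟨u, hu⟩ := hs p (mem_polyhedron_of_forall_ne_inner_lt hp hlt)
  intro hi
  simpa [hi] using hu.1 i (mem_active.2 hp)

end Irredundant

section FacetsOfPolyhedron

variable {n : ℕ} {ι : Type*} {w : ι → Pt n} {h : ι → ℝ}

theorem faceDir_polyhedron_normal (hirr : IsIrredundant w h) (i : ι) :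
    faceDir (polyhedron w h) (w i) = {x | x ∈ polyhedron w h ∧ inner ℝ (w i) x = h i} := by
  obtain ⟨p, hp, hlt⟩ := hirr i
  ext x
  refine and_congr_right fun hx => ⟨fun hmax => (hx i).antisymm ?_, fun heq z hz => ?_⟩
  · exact hp ▸ hmax p (mem_polyhedron_of_forall_ne_inner_lt hp hlt)
  · exact heq ▸ hz i

theorem faceDir_polyhedron_normal_injective (hirr : IsIrredundant w h) :
    Function.Injective fun i => faceDir (polyhedron w h) (w i) := by
  intro i j hij
  obtain ⟨p, hp, hlt⟩ := hirr i
  simp only [faceDir_polyhedron_normal hirr] at hij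
  have hpj : p ∈ {x | x ∈ polyhedron w h ∧ inner ℝ (w j) x = h j} :=
    hij ▸ ⟨mem_polyhedron_of_forall_ne_inner_lt hp hlt, hp⟩
  by_contra hne
  exact (hlt j (Ne.symm hne)).ne hpj.2

theorem vectorSpan_faceDir_polyhedron_normal [Finite ι] (hirr : IsIrredundant w h) (i : ι) :
    vectorSpan ℝ (faceDir (polyhedron w h) (w i)) = (ℝ ∙ w i)ᗮ := by
  have := Fintype.ofFinite ι
  rw [faceDir_polyhedron_normal hirr]
  refine le_antisymm ?_ fun d hd => ?_
  · rw [Submodule.le_orthogonal_iff_le_orthogonal, Submodule.span_singleton_le_iff_mem]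
    exact mem_orthogonal_vectorSpan fun x hx => hx.2
  rw [Submodule.mem_orthogonal_singleton_iff_inner_right] at hd
  obtain ⟨p, hp, hlt⟩ := hirr i
  have hpmem := mem_polyhedron_of_forall_ne_inner_lt hp hlt
  obtain ⟨ε, hε, hmem⟩ := exists_pos_add_smul_mem_polyhedron hpmem (d := d) fun j hj => by
    rcases eq_or_ne j i with rfl | hji
    exacts [hd.le, absurd (mem_active.1 hj) (hlt j hji).ne]
  have hsmul : (p + ε • d) -ᵥ p ∈ vectorSpan ℝ
      {x | x ∈ polyhedron w h ∧ inner ℝ (w i) x = h i} := by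
    refine vsub_mem_vectorSpan ℝ ⟨hmem, ?_⟩ ⟨hpmem, hp⟩
    rw [inner_add_right, real_inner_smul_right, hd, hp, mul_zero, add_zero]
  rw [vsub_eq_sub, add_sub_cancel_left] at hsmul
  exact (Submodule.smul_mem_iff _ hε.ne').1 hsmul

variable [Fintype ι]

theorem isFacet_faceDir_polyhedron_normal (hs : IsSimple w h) (hirr : IsIrredundant w h) (i : ι) :
    IsFacet (polyhedron w h) (faceDir (polyhedron w h) (w i)) := by
  refine ⟨⟨_, rfl⟩, ?_⟩
  rw [vectorSpan_faceDir_polyhedron_normal hirr,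
    finrank_orthogonal_span_singleton_add_one (hs.ne_zero hirr i), finrank_euclideanSpace_fin]

theorem exists_faceDir_polyhedron_normal_eq (hs : IsSimple w h)
    (hbdd : Bornology.IsBounded (polyhedron w h)) (hint : (interior (polyhedron w h)).Nonempty)
    {F : Set (Pt n)} (hF : IsFacet (polyhedron w h) F) :
    ∃ i, faceDir (polyhedron w h) (w i) = F := by
  obtain ⟨α, rfl⟩ := hF.1
  have hcompact := isCompact_of_isClosed_isBounded isClosed_polyhedron hbdd
  have hα := ne_zero_of_isFacet_faceDir (isFullDimPolytope_polyhedron hbdd hint).2 hF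
  obtain ⟨x, hx, hmin⟩ := exists_forall_active_subset (convex_faceDir convex_polyhedron α)
    (faceDir_nonempty hcompact (hint.mono interior_subset) α) fun _ hy => hy.1
  obtain ⟨u, hu⟩ := hs x hx.1
  obtain ⟨a, ha, hsum⟩ := mem_coneGenOn_active_of_forall_inner_le hu hx.1 hx.2
  obtain ⟨i, hi, hai⟩ : ∃ i ∈ active w h x, a i • w i ≠ 0 := by
    by_contra! hzero
    exact hα (hsum.trans (Finset.sum_eq_zero hzero))
  have horth : ∀ j ∈ active w h x, w j ∈ (vectorSpan ℝ (faceDir (polyhedron w h) α))ᗮ :=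
    fun j hj => mem_orthogonal_vectorSpan fun y hy => mem_active.1 (hmin y hy hj)
  have hactive : ∀ j ∈ active w h x, j ≠ i → a j • w j = 0 := fun j hj hji => by
    obtain ⟨c, hc⟩ := hF.exists_smul_eq (horth i hi) (horth j hj) (right_ne_zero_of_smul hai)
    have hpair := hu.1 j hj
    rw [← hc, real_inner_smul_right, hu.2 j hj i hi hji, mul_zero] at hpair
    exact absurd hpair zero_ne_one
  rw [Finset.sum_eq_single_of_mem i hi hactive] at hsum
  refine ⟨i, ?_⟩
  rw [hsum, faceDir_smul ((ha i).lt_of_ne' (left_ne_zero_of_smul hai))]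

theorem hasFacets_polyhedron (hs : IsSimple w h) (hirr : IsIrredundant w h)
    (hbdd : Bornology.IsBounded (polyhedron w h)) (hint : (interior (polyhedron w h)).Nonempty) :
    HasFacets (polyhedron w h) (Fintype.card ι) := by
  have hfacets : {F | IsFacet (polyhedron w h) F} =
      Set.range fun i => faceDir (polyhedron w h) (w i) :=
    Set.Subset.antisymm (fun _ => exists_faceDir_polyhedron_normal_eq hs hbdd hint)
      (Set.range_subset_iff.2 (isFacet_faceDir_polyhedron_normal hs hirr))
  rw [HasFacets, hfacets, ← Set.image_univ,
    (faceDir_polyhedron_normal_injective hirr).encard_image, Set.encard_univ,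
    ENat.card_eq_coe_fintype_card]

end FacetsOfPolyhedron

/-! ### Facet presentations of Delzant polytopes -/

theorem mem_of_forall_exists_inner_le {E : Type*} [NormedAddCommGroup E] [InnerProductSpace ℝ E]
    [CompleteSpace E] {P : Set E} (hconv : Convex ℝ P) (hclosed : IsClosed P) {x : E}
    (h : ∀ α : E, ∃ p ∈ P, inner ℝ α x ≤ inner ℝ α p) : x ∈ P := by
  by_contra hx
  obtain ⟨f, c, hP, hc⟩ := geometric_hahn_banach_closed_point hconv hclosed hx
  obtain ⟨p, hp, hxp⟩ := h ((InnerProductSpace.toDual ℝ E).symm f)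
  simp only [InnerProductSpace.toDual_symm_apply] at hxp
  exact (hxp.trans_lt (hP p hp)).not_gt hc

section ConeGen

variable {n k : ℕ} {g : Fin k → Pt n}

theorem generator_mem_coneGen (g : Fin k → Pt n) (i : Fin k) : g i ∈ coneGen g :=
  ⟨Pi.single i 1, (Pi.single_nonneg.2 zero_le_one : (0 : Fin k → ℝ) ≤ Pi.single i 1), by
    simp [Pi.single_apply]⟩

theorem inner_le_inner_of_mem_coneGen {α x y : Pt n} (hα : α ∈ coneGen g)
    (hg : ∀ i, inner ℝ (g i) x ≤ inner ℝ (g i) y) : inner ℝ α x ≤ inner ℝ α y := by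
  obtain ⟨a, ha, rfl⟩ := hα
  simp only [sum_inner, real_inner_smul_left]
  exact Finset.sum_le_sum fun i _ => mul_le_mul_of_nonneg_left (hg i) (ha i)

theorem exists_nonneg_smul_eq_of_add_eq_generator (hg : LinearIndependent ℝ g) {x y : Pt n}
    (hx : x ∈ coneGen g) (hy : y ∈ coneGen g) {i : Fin k} (hxy : x + y = g i) :
    ∃ b : ℝ, 0 ≤ b ∧ b • g i = y := by
  obtain ⟨a, ha, rfl⟩ := hx
  obtain ⟨b, hb, rfl⟩ := hy
  have hab : ∀ j, a j + b j = (Pi.single i 1 : Fin k → ℝ) j := fun j => by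
    refine sub_eq_zero.1 (Fintype.linearIndependent_iff.1 hg
      (fun j => a j + b j - (Pi.single i 1 : Fin k → ℝ) j) ?_ j)
    simp only [sub_smul, add_smul, Finset.sum_sub_distrib, Finset.sum_add_distrib, hxy]
    simp [Pi.single_apply]
  refine ⟨b i, hb i, Eq.symm (Fintype.sum_eq_single i fun j hji => ?_)⟩
  have hj := hab j
  rw [Pi.single_eq_of_ne hji] at hj
  rw [(add_eq_zero_iff_of_nonneg (ha j) (hb j)).1 hj |>.2, zero_smul]

end ConeGen

section FacetNormal

variable {n : ℕ} {P : Set (Pt n)}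

theorem IsFullDimPolytope.convex (hP : IsFullDimPolytope P) : Convex ℝ P := by
  obtain ⟨⟨S, rfl⟩, -⟩ := hP
  exact convex_convexHull ℝ _

theorem IsFullDimPolytope.isCompact (hP : IsFullDimPolytope P) : IsCompact P := by
  obtain ⟨⟨S, rfl⟩, -⟩ := hP
  exact S.finite_toSet.isCompact_convexHull ℝ

theorem IsFullDimPolytope.interior_nonempty (hP : IsFullDimPolytope P) :
    (interior P).Nonempty :=
  hP.convex.interior_nonempty_iff_affineSpan_eq_top.2 hP.2

theorem IsFullDimPolytope.nonempty (hP : IsFullDimPolytope P) : P.Nonempty :=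
  hP.interior_nonempty.mono interior_subset

/-- An outer normal vector of a facet, expressed through the normal cone: the vector spans the
normal cone of its own face. -/
def IsFacetNormal (P : Set (Pt n)) (w : Pt n) : Prop :=
  w ≠ 0 ∧ ∀ β ∈ normalCone P (faceDir P w), ∃ b : ℝ, 0 ≤ b ∧ b • w = β

theorem mem_normalCone_faceDir (P : Set (Pt n)) (α : Pt n) : α ∈ normalCone P (faceDir P α) :=
  Set.Subset.rfl

theorem mem_faceDir_convexHull {S : Set (Pt n)} {α p : Pt n} (hp : p ∈ convexHull ℝ S)
    (hS : ∀ s ∈ S, inner ℝ α s ≤ inner ℝ α p) : p ∈ faceDir (convexHull ℝ S) α :=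
  ⟨hp, convexHull_min hS (convex_halfSpace_le (innerₛₗ ℝ α).isLinear _)⟩

theorem exists_pos_add_smul_mem_normalCone {S : Set (Pt n)} (hS : S.Finite) {w d : Pt n}
    (hd : d ∈ (vectorSpan ℝ (faceDir (convexHull ℝ S) w))ᗮ) :
    ∃ ε > (0 : ℝ), w + ε • d ∈ normalCone (convexHull ℝ S) (faceDir (convexHull ℝ S) w) := by
  rcases (faceDir (convexHull ℝ S) w).eq_empty_or_nonempty with hempty | ⟨p, hp⟩
  · exact ⟨1, one_pos, hempty ▸ Set.empty_subset _⟩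
  have hmax : ∀ᶠ ε in 𝓝[>] (0 : ℝ), ∀ s ∈ S, inner ℝ (w + ε • d) s ≤ inner ℝ (w + ε • d) p := by
    refine (eventually_all_finite hS).2 fun s hs => ?_
    have hsP : s ∈ convexHull ℝ S := subset_convexHull ℝ _ hs
    by_cases hsF : s ∈ faceDir (convexHull ℝ S) w
    · refine Eventually.of_forall fun ε => ?_
      rw [inner_add_left, inner_add_left, real_inner_smul_left, real_inner_smul_left,
        inner_eq_of_mem_orthogonal_vectorSpan hd hsF hp]
      exact add_le_add_left (hp.2 s hsP) _
    · have hlt : inner ℝ (w + (0 : ℝ) • d) s < inner ℝ (w + (0 : ℝ) • d) p := by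
        rw [zero_smul, add_zero]
        by_contra! hle
        exact hsF ⟨hsP, fun x hx => (hp.2 x hx).trans hle⟩
      have hcont : ∀ x, Continuous fun ε : ℝ => inner ℝ (w + ε • d) x := fun x => by fun_prop
      have hlt' := ((hcont s).tendsto 0).eventually_lt ((hcont p).tendsto 0) hlt
      exact nhdsWithin_le_nhds (hlt'.mono fun _ => le_of_lt)
  obtain ⟨ε, hε, hεpos⟩ := (hmax.and self_mem_nhdsWithin).exists
  have horth : w + ε • d ∈ (vectorSpan ℝ (faceDir (convexHull ℝ S) w))ᗮ :=
    add_mem (mem_orthogonal_vectorSpan_of_mem_normalCone (mem_normalCone_faceDir _ w))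
      (Submodule.smul_mem _ ε hd)
  refine ⟨ε, hεpos, fun q hq => mem_faceDir_convexHull hq.1 fun s hs => ?_⟩
  exact (hε s hs).trans_eq (inner_eq_of_mem_orthogonal_vectorSpan horth hp hq)

theorem isFacetNormal_generator (hP : IsFullDimPolytope P) {F : Set (Pt n)} {k : ℕ}
    {g : Fin k → Pt n} (hg : LinearIndependent ℝ g) (hF : normalCone P F = coneGen g)
    (i : Fin k) : IsFacetNormal P (g i) := by
  obtain ⟨S, rfl⟩ := hP.1
  have hFi : F ⊆ faceDir _ (g i) := hF.symm.subset (generator_mem_coneGen g i)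
  refine ⟨hg.ne_zero i, fun β hβ => ?_⟩
  obtain ⟨ε, hε, hmem⟩ := exists_pos_add_smul_mem_normalCone S.finite_toSet
    (neg_mem (mem_orthogonal_vectorSpan_of_mem_normalCone hβ))
  have hsub : ∀ γ ∈ normalCone (convexHull ℝ (S : Set (Pt n))) (faceDir _ (g i)),
      γ ∈ coneGen g := fun γ hγ => hF.subset (hFi.trans hγ)
  have hεβ : ε • β ∈ coneGen g := by
    obtain ⟨a, ha, rfl⟩ := hsub β hβ
    exact ⟨fun j => ε * a j, fun j => mul_nonneg hε.le (ha j), by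
      simp only [Finset.smul_sum, smul_smul]⟩
  obtain ⟨b, hb, hbβ⟩ := exists_nonneg_smul_eq_of_add_eq_generator hg (hsub _ hmem) hεβ
    (i := i) (by rw [smul_neg, neg_add_cancel_right])
  exact ⟨ε⁻¹ * b, by positivity, by rw [mul_smul, hbβ, inv_smul_smul₀ hε.ne']⟩

theorem IsFacetNormal.isFacet (hP : IsFullDimPolytope P) {w : Pt n} (hw : IsFacetNormal P w) :
    IsFacet P (faceDir P w) := by
  obtain ⟨S, rfl⟩ := hP.1
  have hspan : (vectorSpan ℝ (faceDir (convexHull ℝ (S : Set (Pt n))) w))ᗮ = ℝ ∙ w := by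
    refine le_antisymm (fun d hd => ?_) ((Submodule.span_singleton_le_iff_mem _ _).2
      (mem_orthogonal_vectorSpan_of_mem_normalCone (mem_normalCone_faceDir _ w)))
    obtain ⟨ε, hε, hmem⟩ := exists_pos_add_smul_mem_normalCone S.finite_toSet hd
    obtain ⟨b, -, hb⟩ := hw.2 _ hmem
    refine Submodule.mem_span_singleton.2 ⟨ε⁻¹ * (b - 1), ?_⟩
    rw [mul_smul, sub_smul, hb, one_smul, add_sub_cancel_left, inv_smul_smul₀ hε.ne']
  refine ⟨⟨w, rfl⟩, ?_⟩
  rw [← Submodule.orthogonal_orthogonal (vectorSpan ℝ _), hspan,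
    finrank_orthogonal_span_singleton_add_one hw.1, finrank_euclideanSpace_fin]

theorem IsDelzant.exists_intPt_of_isFacet (hP : IsDelzant P) {F : Set (Pt n)}
    (hF : IsFacet P F) : ∃ v : Fin n → ℤ, intPt v ≠ 0 ∧ faceDir P (intPt v) = F := by
  obtain ⟨α, rfl⟩ := hF.1
  have hα := ne_zero_of_isFacet_faceDir hP.1.2 hF
  obtain ⟨k, v, -, hli, hcone, -⟩ := hP.2 _ ⟨_, hF.1, rfl⟩
  obtain ⟨a, ha, hsum⟩ := hcone.subset (mem_normalCone_faceDir P α)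
  obtain ⟨i, -, hi⟩ : ∃ i ∈ Finset.univ, a i • intPt (v i) ≠ 0 :=
    Finset.exists_ne_zero_of_sum_ne_zero (hsum ▸ hα)
  have horth : ∀ j, intPt (v j) ∈ (vectorSpan ℝ (faceDir P α))ᗮ := fun j =>
    mem_orthogonal_vectorSpan_of_mem_normalCone
      (hcone.symm.subset (generator_mem_coneGen (fun i => intPt (v i)) j))
  have hunique : ∀ j, j = i := fun j => by
    by_contra hji
    obtain ⟨c, hc⟩ := hF.exists_smul_eq (horth i) (horth j) (hli.ne_zero i)
    refine hli.notMem_span_image (s := {i}) hji ?_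
    rw [Set.image_singleton]
    exact Submodule.mem_span_singleton.2 ⟨c, hc⟩
  rw [Finset.sum_eq_single i (fun j _ hji => absurd (hunique j) hji) (by simp)] at hsum
  exact ⟨v i, hli.ne_zero i, by
    rw [hsum, faceDir_smul ((ha i).lt_of_ne' (left_ne_zero_of_smul hi))]⟩

theorem IsDelzant.eq_polyhedron_facets (hP : IsDelzant P) {ι : Type*} {v : ι → Fin n → ℤ}
    (hv : ∀ i, intPt (v i) ≠ 0) (hfacets : ∀ F, IsFacet P F → ∃ i, faceDir P (intPt (v i)) = F)
    {p : ι → Pt n} (hp : ∀ i, p i ∈ faceDir P (intPt (v i))) :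
    P = polyhedron (fun i => intPt (v i)) fun i => inner ℝ (intPt (v i)) (p i) := by
  refine Set.Subset.antisymm (fun x hx i => (hp i).2 x hx) fun x hx => ?_
  refine mem_of_forall_exists_inner_le hP.1.convex hP.1.isCompact.isClosed fun α => ?_
  obtain ⟨q, hq⟩ := faceDir_nonempty hP.1.isCompact hP.1.nonempty α
  obtain ⟨k, g, -, hli, hcone, -⟩ := hP.2 _ ⟨_, ⟨α, rfl⟩, rfl⟩
  refine ⟨q, hq.1, inner_le_inner_of_mem_coneGen (hcone.subset (mem_normalCone_faceDir P α))
    fun j => ?_⟩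
  have hgj := isFacetNormal_generator hP.1 hli hcone j
  have hqj : q ∈ faceDir P (intPt (g j)) :=
    hcone.symm.subset (generator_mem_coneGen (fun j => intPt (g j)) j) hq
  obtain ⟨i, hi⟩ := hfacets _ (hgj.isFacet hP.1)
  obtain ⟨b, hb, hbv⟩ := hgj.2 _ (hi ▸ mem_normalCone_faceDir P (intPt (v i)))
  have hbpos : 0 < b := hb.lt_of_ne' (left_ne_zero_of_smul (hbv.trans_ne (hv i)))
  have hle : inner ℝ (intPt (v i)) x ≤ inner ℝ (intPt (v i)) q :=
    (hx i).trans ((hi.symm.subset hqj).2 _ (hp i).1)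
  rwa [← hbv, real_inner_smul_left, real_inner_smul_left, mul_le_mul_iff_right₀ hbpos] at hle

theorem IsDelzant.exists_eq_polyhedron (hP : IsDelzant P) {m : ℕ} (hm : HasFacets P m) :
    ∃ (v : Fin m → Fin n → ℤ) (h : Fin m → ℝ), (∀ i, intPt (v i) ≠ 0) ∧
      P = polyhedron (fun i => intPt (v i)) h := by
  have hfin : Finite {F | IsFacet P F} := Set.finite_of_encard_eq_coe hm
  have hcard : Nat.card {F | IsFacet P F} = m := by
    rw [Nat.card_coe_set_eq, Set.ncard, hm, ENat.toNat_natCast]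
  let e : {F | IsFacet P F} ≃ Fin m := Finite.equivFinOfCardEq hcard
  choose v hv hface using fun i => hP.exists_intPt_of_isFacet (e.symm i).2
  choose p hp using fun i => faceDir_nonempty hP.1.isCompact hP.1.nonempty (intPt (v i))
  exact ⟨v, _, hv, hP.eq_polyhedron_facets hv (fun F hF => ⟨e ⟨F, hF⟩, by simp [hface]⟩) hp⟩

end FacetNormal

/-! ### Upper bounds for the dimension -/

section Upper

variable {n m : ℕ}

theorem exists_nat_closedBall_subset_and_subset_closedBall {E : Type*} [NormedAddCommGroup E]
    {P : Set E} (hint : (interior P).Nonempty) (hbdd : Bornology.IsBounded P) :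
    ∃ k : ℕ, (∃ c, closedBall c (1 / ((k : ℝ) + 1)) ⊆ P) ∧ P ⊆ closedBall 0 k := by
  obtain ⟨c, hc⟩ := hint
  obtain ⟨r, hr, hrP⟩ := nhds_basis_closedBall.mem_iff.1 (mem_interior_iff_mem_nhds.1 hc)
  obtain ⟨R, hR⟩ := hbdd.subset_closedBall 0
  obtain ⟨k₁, hk₁⟩ := exists_nat_one_div_lt hr
  obtain ⟨k₂, hk₂⟩ := exists_nat_ge R
  refine ⟨max k₁ k₂, ⟨c, (closedBall_subset_closedBall ?_).trans hrP⟩,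
    hR.trans (closedBall_subset_closedBall (hk₂.trans (by exact_mod_cast le_max_right _ _)))⟩
  exact (Nat.one_div_le_one_div (le_max_left _ _)).trans hk₁.le

theorem delzantFacetsV_subset_iUnion_image_fatHeights :
    delzantFacetsV n m ⊆ ⋃ (v : {v : Fin m → Fin n → ℤ // ∀ i, intPt (v i) ≠ 0}) (k : ℕ),
      polytope (fun i => intPt (v.1 i)) ''
        fatHeights (fun i => intPt (v.1 i)) (1 / ((k : ℝ) + 1)) k := by
  rintro P ⟨hP, hm⟩
  obtain ⟨v, h, hv, hPh⟩ := hP.exists_eq_polyhedron hm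
  obtain ⟨k, hk⟩ := exists_nat_closedBall_subset_and_subset_closedBall P.interior_nonempty
    P.body.isCompact.isBounded
  change (∃ c, closedBall c _ ⊆ P.toSet) ∧ P.toSet ⊆ _ at hk
  rw [hPh] at hk
  exact Set.mem_iUnion₂.2 ⟨⟨v, hv⟩, k, h, hk, polytope_eq hPh⟩

theorem dimH_image_delzantFacetsV_le {X : Type*} [EMetricSpace X] {f : ProperBody n → X}
    (hf : ∀ w : Fin m → Pt n, (∀ i, 1 ≤ ‖w i‖) → ∀ r > 0, ∀ R,
      ∃ K, LipschitzOnWith K (fun h => f (polytope w h)) (fatHeights w r R)) :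
    dimH (f '' delzantFacetsV n m) ≤ m := by
  refine (dimH_mono (Set.image_mono delzantFacetsV_subset_iUnion_image_fatHeights)).trans ?_
  simp only [Set.image_iUnion, dimH_iUnion, Set.image_image]
  refine iSup₂_le fun v k => ?_
  obtain ⟨K, hK⟩ := hf _ (fun i => one_le_norm_intPt (v.2 i)) _ Nat.one_div_pos_of_nat k
  refine hK.dimH_image_le.trans ((dimH_mono (Set.subset_univ _)).trans ?_)
  rw [Real.dimH_univ_pi, Fintype.card_fin]

theorem delzantFacetsH_eq_image :
    delzantFacetsH n m = ProperBody.body '' delzantFacetsV n m := by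
  ext P
  refine ⟨fun hP => ⟨⟨P, hP.1.1.interior_nonempty⟩, hP, rfl⟩, ?_⟩
  rintro ⟨P, hP, rfl⟩
  exact hP

theorem dimH_delzantFacetsH_le : dimH (delzantFacetsH n m) ≤ m := by
  rw [delzantFacetsH_eq_image]
  exact dimH_image_delzantFacetsV_le fun w hw r hr R => exists_lipschitzOnWith_body_polytope hr hw

theorem dimH_delzantFacetsV_le : dimH (delzantFacetsV n m) ≤ m := by
  rw [← Set.image_id (delzantFacetsV n m)]
  exact dimH_image_delzantFacetsV_le fun w hw r hr R => exists_lipschitzOnWith_polytope hr hw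

theorem lipschitzWith_mk : LipschitzWith 1 (BodyOrbits.mk : ProperBody n → BodyOrbits n) :=
  LipschitzWith.of_edist_le BodyOrbits.edist_mk_le

theorem dimH_delzantFacetsQuot_le : dimH (delzantFacetsQuot n m) ≤ dimH (delzantFacetsV n m) :=
  lipschitzWith_mk.dimH_image_le _

end Upper

/-! ### Volumes near a facet -/

section Cylinder

variable {E : Type*} [NormedAddCommGroup E] [InnerProductSpace ℝ E] {w u : E} {ρ : ℝ}

/-- The infinite open cylinder of radius `ρ` around the line spanned by `u`, projecting along the
hyperplanes orthogonal to `w`; it is only used for `inner ℝ w u = 1`. -/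
def cylinder (w u : E) (ρ : ℝ) : Set E := {z | ‖z - (inner ℝ w z : ℝ) • u‖ < ρ}

theorem isOpen_cylinder : IsOpen (cylinder w u ρ) :=
  isOpen_lt (by fun_prop) continuous_const

theorem smul_mem_cylinder (hu : inner ℝ w u = 1) (hρ : 0 < ρ) (t : ℝ) :
    t • u ∈ cylinder w u ρ := by
  simpa [cylinder, real_inner_smul_right, hu] using hρ

theorem preimage_add_smul_cylinder (hu : inner ℝ w u = 1) (t : ℝ) :
    (fun z => z + t • u) ⁻¹' cylinder w u ρ = cylinder w u ρ := by
  ext z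
  simp [cylinder, inner_add_right, real_inner_smul_right, hu, add_smul]

theorem norm_lt_of_mem_cylinder {z : E} (hz : z ∈ cylinder w u ρ) {T : ℝ}
    (hT : |inner ℝ w z| ≤ T) : ‖z‖ < ρ + T * ‖u‖ := calc
  ‖z‖ ≤ ‖z - (inner ℝ w z : ℝ) • u‖ + ‖(inner ℝ w z : ℝ) • u‖ := norm_le_norm_sub_add _ _
  _ < ρ + T * ‖u‖ := by
    rw [norm_smul, Real.norm_eq_abs]
    exact add_lt_add_of_lt_of_le hz (by gcongr)

variable [FiniteDimensional ℝ E] [MeasurableSpace E] [BorelSpace E] (μ : Measure E)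
  [μ.IsAddHaarMeasure]

theorem isAddLeftInvariant_map_restrict_cylinder (hu : inner ℝ w u = 1) :
    ((μ.restrict (cylinder w u ρ)).map (inner ℝ w)).IsAddLeftInvariant := by
  have hw : Measurable fun z : E => (inner ℝ w z : ℝ) := by fun_prop
  refine ⟨fun t => Measure.ext fun s hs => ?_⟩
  have hs' := hs.preimage (measurable_const_add t)
  rw [Measure.map_apply (measurable_const_add t) hs, Measure.map_apply hw hs',
    Measure.map_apply hw hs, Measure.restrict_apply (hw hs'), Measure.restrict_apply (hw hs),
    ← measure_preimage_add_right μ (t • u) ((inner ℝ w) ⁻¹' s ∩ _), Set.preimage_inter,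
    preimage_add_smul_cylinder hu]
  congr 2
  ext z
  simp [inner_add_right, real_inner_smul_right, hu, add_comm]

theorem isFiniteMeasureOnCompacts_map_restrict_cylinder :
    IsFiniteMeasureOnCompacts ((μ.restrict (cylinder w u ρ)).map (inner ℝ w)) := by
  have hw : Measurable fun z : E => (inner ℝ w z : ℝ) := by fun_prop
  refine ⟨fun K hK => ?_⟩
  obtain ⟨T, hT⟩ := hK.isBounded.exists_norm_le
  rw [Measure.map_apply hw hK.measurableSet, Measure.restrict_apply (hw hK.measurableSet)]
  refine (measure_mono fun z hz => ?_).trans_lt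
    (measure_ball_lt_top (μ := μ) (x := 0) (r := ρ + T * ‖u‖))
  exact mem_ball_zero_iff.2 (norm_lt_of_mem_cylinder hz.2 (hT _ hz.1))

theorem exists_measure_cylinder_inter_eq (hu : inner ℝ w u = 1) (hρ : 0 < ρ) :
    ∃ c : ℝ≥0, c ≠ 0 ∧ ∀ a b : ℝ,
      μ (cylinder w u ρ ∩ {z | inner ℝ w z ∈ Set.Ioc a b}) = c * ENNReal.ofReal (b - a) := by
  have hw : Continuous fun z : E => (inner ℝ w z : ℝ) := by fun_prop
  set ν := (μ.restrict (cylinder w u ρ)).map (inner ℝ w) with hν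
  have := isAddLeftInvariant_map_restrict_cylinder μ hu (ρ := ρ)
  have := isFiniteMeasureOnCompacts_map_restrict_cylinder μ (w := w) (u := u) (ρ := ρ)
  have hscale : ν = ν.addHaarScalarFactor volume • volume :=
    Measure.isAddLeftInvariant_eq_smul ν volume
  refine ⟨ν.addHaarScalarFactor volume, fun hzero => ?_, fun a b => ?_⟩
  · have hν₀ : ν Set.univ = 0 := by rw [hscale, hzero, zero_smul, Measure.coe_zero, Pi.zero_apply]
    rw [hν, Measure.map_apply hw.measurable .univ, Set.preimage_univ,
      Measure.restrict_apply_univ] at hν₀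
    exact (isOpen_cylinder.measure_pos μ ⟨_, smul_mem_cylinder hu hρ 0⟩).ne' hν₀
  · calc μ (cylinder w u ρ ∩ {z | inner ℝ w z ∈ Set.Ioc a b})
        = ν (Set.Ioc a b) := by
          rw [hν, Measure.map_apply hw.measurable measurableSet_Ioc,
            Measure.restrict_apply (hw.measurable measurableSet_Ioc), Set.inter_comm]
          rfl
      _ = (ν.addHaarScalarFactor volume • (volume : Measure ℝ)) (Set.Ioc a b) :=
          DFunLike.congr_fun hscale _
      _ = ν.addHaarScalarFactor volume * ENNReal.ofReal (b - a) := by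
          rw [Measure.smul_apply, Real.volume_Ioc, ENNReal.smul_def, smul_eq_mul]

end Cylinder

section NearFacet

variable {ι E : Type*} [Finite ι] [NormedAddCommGroup E] [InnerProductSpace ℝ E] {w : ι → E}
  {h : ι → ℝ}

theorem exists_inner_eq_one {w : E} (hw : w ≠ 0) : ∃ u : E, inner ℝ w u = 1 := by
  refine ⟨(‖w‖ ^ 2)⁻¹ • w, ?_⟩
  rw [real_inner_smul_right, real_inner_self_eq_norm_sq]
  exact inv_mul_cancel₀ (pow_ne_zero _ (norm_ne_zero_iff.2 hw))

theorem eventually_forall_inner_lt {s : Set ι} {p : E} (hp : ∀ j ∈ s, inner ℝ (w j) p < h j) :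
    ∀ᶠ z : (ι → ℝ) × E in 𝓝 (h, p), ∀ j ∈ s, inner ℝ (w j) z.2 < z.1 j := by
  refine (eventually_all_finite s.toFinite).2 fun j hj => ?_
  have hcont : Continuous fun z : (ι → ℝ) × E => inner ℝ (w j) z.2 := by fun_prop
  have hcont' : Continuous fun z : (ι → ℝ) × E => z.1 j := by fun_prop
  exact (hcont.tendsto (h, p)).eventually_lt (hcont'.tendsto (h, p)) (hp j hj)

variable [FiniteDimensional ℝ E] [MeasurableSpace E] [BorelSpace E] (μ : Measure E)
  [μ.IsAddHaarMeasure]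

theorem exists_eventually_ofReal_sub_le_measure_sdiff {i : ι} (hw : w i ≠ 0) {p : E}
    (hp : inner ℝ (w i) p = h i) (hlt : ∀ j, j ≠ i → inner ℝ (w j) p < h j) :
    ∃ C : ℝ≥0, ∀ᶠ q : (ι → ℝ) × (ι → ℝ) in 𝓝 (h, h),
      ENNReal.ofReal (q.1 i - q.2 i) ≤ C * μ (polyhedron w q.1 \ polyhedron w q.2) := by
  obtain ⟨u, hu⟩ := exists_inner_eq_one hw
  obtain ⟨V, hV, B, hB, hVB⟩ := mem_nhds_prod_iff.1
    (eventually_forall_inner_lt (s := {j | j ≠ i}) hlt)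
  obtain ⟨r, hr, hrB⟩ := Metric.mem_nhds_iff.1 hB
  obtain ⟨c, hc, hcyl⟩ := exists_measure_cylinder_inter_eq μ hu (half_pos hr)
  obtain ⟨ε, hε, hεu⟩ : ∃ ε > 0, r / 2 + ε * ‖u‖ ≤ r := by
    have hpos : 0 < ‖u‖ + 1 := by positivity
    refine ⟨r / 2 / (‖u‖ + 1), by positivity, ?_⟩
    have hmul := mul_le_mul_of_nonneg_left (lt_add_one ‖u‖).le
      (show 0 ≤ r / 2 / (‖u‖ + 1) by positivity)
    rw [div_mul_cancel₀ _ hpos.ne'] at hmul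
    linarith
  have hnear : ∀ᶠ g : ι → ℝ in 𝓝 h, g ∈ V ∧ |g i - h i| < ε := by
    refine (eventually_mem_set.2 hV).and ?_
    exact ((continuous_apply i).tendsto h).eventually (Metric.ball_mem_nhds _ hε)
  refine ⟨c⁻¹, ?_⟩
  filter_upwards [hnear.prod_nhds hnear] with q hqq
  obtain ⟨⟨hqV, hq⟩, -, hq'⟩ := hqq
  have hsub : cylinder (w i) u (r / 2) ∩
      {z | inner ℝ (w i) z ∈ Set.Ioc (q.2 i - h i) (q.1 i - h i)} ⊆
      (fun z => z + p) ⁻¹' (polyhedron w q.1 \ polyhedron w q.2) := by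
    rintro z ⟨hz, hzl, hzr⟩
    have hi : inner ℝ (w i) (z + p) = inner ℝ (w i) z + h i := by rw [inner_add_right, hp]
    have hnorm := (norm_lt_of_mem_cylinder hz (T := ε) (abs_le.2 ⟨by linarith [(abs_lt.1 hq').1],
      by linarith [(abs_lt.1 hq).2]⟩)).trans_le hεu
    have hzp : z + p ∈ B := hrB (by rwa [mem_ball, dist_eq_norm, add_sub_cancel_right])
    refine ⟨fun j => ?_, fun hmem => ?_⟩
    · rcases eq_or_ne j i with rfl | hj
      · linarith
      · exact (hVB (Set.mk_mem_prod hqV hzp) j hj).le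
    · linarith [hmem i]
  have hle := measure_mono (μ := μ) hsub
  rw [measure_preimage_add_right, hcyl, sub_sub_sub_cancel_right] at hle
  rwa [ENNReal.coe_inv hc, ← ENNReal.div_eq_inv_mul, ENNReal.le_div_iff_mul_le
    (.inl (ENNReal.coe_ne_zero.2 hc)) (.inl ENNReal.coe_ne_top), mul_comm]

end NearFacet

/-! ### Distances of polyhedra with close right-hand sides -/

section LowerBounds

variable {n : ℕ} {ι : Type*} {w : ι → Pt n} {h h' : ι → ℝ}

theorem exists_eventually_edist_le_mul_of_forall_apply [Fintype ι]
    {d : (ι → ℝ) → (ι → ℝ) → ℝ≥0∞}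
    (hd : ∀ i, ∃ C : ℝ≥0, ∀ᶠ q : (ι → ℝ) × (ι → ℝ) in 𝓝 (h, h),
      ENNReal.ofReal (q.1 i - q.2 i) ≤ C * d q.1 q.2) (hsymm : ∀ a b, d a b = d b a) :
    ∃ C : ℝ≥0, ∀ᶠ q : (ι → ℝ) × (ι → ℝ) in 𝓝 (h, h), edist q.1 q.2 ≤ C * d q.1 q.2 := by
  choose C hC using hd
  refine ⟨∑ i, C i, ?_⟩
  have hall := eventually_all.2 hC
  have hswap : Tendsto Prod.swap (𝓝 (h, h)) (𝓝 (h, h)) := continuous_swap.tendsto (h, h)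
  filter_upwards [hall, hswap.eventually hall] with q hq hq'
  refine edist_pi_le_iff.2 fun i => ?_
  have hCi : (C i : ℝ≥0∞) ≤ (∑ i, C i : ℝ≥0) :=
    ENNReal.coe_le_coe.2 (Finset.single_le_sum (fun _ _ => zero_le) (Finset.mem_univ i))
  have hi := (hq i).trans (mul_le_mul_left hCi _)
  have hi' := (hq' i).trans (mul_le_mul_left hCi _)
  rw [Prod.fst_swap, Prod.snd_swap, hsymm] at hi'
  rw [edist_dist, Real.dist_eq]
  rcases abs_choice (q.1 i - q.2 i) with habs | habs
  · rwa [habs]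
  · rwa [habs, neg_sub]

theorem exists_eventually_edist_le_mul_edist_polytope [Fintype ι] (hw : ∀ i, w i ≠ 0)
    (hirr : IsIrredundant w h)
    (htoSet : ∀ᶠ h' in 𝓝 h, (polytope w h').toSet = polyhedron w h') :
    ∃ C : ℝ≥0, ∀ᶠ q : (ι → ℝ) × (ι → ℝ) in 𝓝 (h, h),
      edist q.1 q.2 ≤ C * edist (polytope w q.1) (polytope w q.2) := by
  refine exists_eventually_edist_le_mul_of_forall_apply
    (d := fun a b => edist (polytope w a) (polytope w b)) (fun i => ?_) fun _ _ => edist_comm _ _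
  obtain ⟨p, hp, hlt⟩ := hirr i
  obtain ⟨C, hC⟩ := exists_eventually_ofReal_sub_le_measure_sdiff volume (hw i) hp hlt
  refine ⟨C, ?_⟩
  filter_upwards [hC, htoSet.prod_nhds htoSet] with q hq hqq
  rw [ProperBody.edist_def, hqq.1, hqq.2]
  exact hq.trans (by gcongr; exact le_self_add)

theorem ofReal_sub_le_nnnorm_mul_edist_body (hirr : IsIrredundant w h)
    (hP : (polytope w h).toSet = polyhedron w h) (hP' : (polytope w h').toSet = polyhedron w h')
    (i : ι) : ENNReal.ofReal (h i - h' i) ≤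
      ‖w i‖₊ * edist (polytope w h).body (polytope w h').body := by
  obtain ⟨p, hp, hlt⟩ := hirr i
  have hpP : p ∈ (polytope w h).toSet := hP ▸ mem_polyhedron_of_forall_ne_inner_lt hp hlt
  obtain ⟨p', hp'P', hdist⟩ := (polytope w h').body.isCompact.exists_infDist_eq_dist
    (polytope w h').body.nonempty p
  have hp' : inner ℝ (w i) p' ≤ h' i := (hP' ▸ hp'P' : p' ∈ polyhedron w h') i
  have hsub : h i - h' i ≤ ‖w i‖ * dist (polytope w h).body (polytope w h').body :=
    calc h i - h' i ≤ inner ℝ (w i) (p - p') := by rw [inner_sub_right, hp]; linarith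
      _ ≤ ‖w i‖ * dist p p' := (real_inner_le_norm _ _).trans_eq (by rw [dist_eq_norm])
      _ ≤ ‖w i‖ * dist (polytope w h).body (polytope w h').body := by
        rw [← hdist, ← ConvexBody.hausdorffDist_coe]
        gcongr
        exact infDist_le_hausdorffDist_of_mem hpP ConvexBody.hausdorffEDist_ne_top
  calc ENNReal.ofReal (h i - h' i)
      ≤ ENNReal.ofReal (‖w i‖ * dist (polytope w h).body (polytope w h').body) :=
        ENNReal.ofReal_le_ofReal hsub
    _ = ‖w i‖₊ * edist (polytope w h).body (polytope w h').body := by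
        rw [ENNReal.ofReal_mul (norm_nonneg _), ofReal_norm, edist_dist]; rfl

theorem exists_eventually_edist_le_mul_edist_body_polytope [Fintype ι]
    (hirr : ∀ᶠ h' in 𝓝 h, IsIrredundant w h')
    (htoSet : ∀ᶠ h' in 𝓝 h, (polytope w h').toSet = polyhedron w h') :
    ∃ C : ℝ≥0, ∀ᶠ q : (ι → ℝ) × (ι → ℝ) in 𝓝 (h, h),
      edist q.1 q.2 ≤ C * edist (polytope w q.1).body (polytope w q.2).body := by
  refine exists_eventually_edist_le_mul_of_forall_apply
    (d := fun a b => edist (polytope w a).body (polytope w b).body) (fun i => ⟨‖w i‖₊, ?_⟩)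
    fun _ _ => edist_comm _ _
  filter_upwards [hirr.prod_nhds htoSet, htoSet.prod_nhds htoSet] with q hq hq'
  exact ofReal_sub_le_nnnorm_mul_edist_body hq.1 hq'.1 hq'.2 i

end LowerBounds

/-! ### Stability under perturbations of the right-hand sides -/

section Stability

variable {ι E : Type*} [NormedAddCommGroup E] [InnerProductSpace ℝ E] {w : ι → E}
  {h : ι → ℝ}

theorem eventually_notMem_polyhedron {x : E} (hx : x ∉ polyhedron w h) :
    ∀ᶠ z : (ι → ℝ) × E in 𝓝 (h, x), z.2 ∉ polyhedron w z.1 := by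
  obtain ⟨i, hi⟩ := not_forall.1 hx
  have hcont : Continuous fun z : (ι → ℝ) × E => z.1 i := by fun_prop
  have hcont' : Continuous fun z : (ι → ℝ) × E => inner ℝ (w i) z.2 := by fun_prop
  exact ((hcont.tendsto (h, x)).eventually_lt (hcont'.tendsto (h, x)) (not_le.1 hi)).mono
    fun z hz hmem => (hmem i).not_gt hz

section Finite

variable [Finite ι]

theorem IsIrredundant.eventually (hw : ∀ i, w i ≠ 0) (hirr : IsIrredundant w h) :
    ∀ᶠ h' in 𝓝 h, IsIrredundant w h' := by
  refine eventually_all.2 fun i => ?_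
  obtain ⟨p, hp, hlt⟩ := hirr i
  obtain ⟨u, hu⟩ := exists_inner_eq_one (hw i)
  have hcont : Continuous fun h' : ι → ℝ => (h', p + (h' i - h i) • u) := by fun_prop
  have htendsto := hcont.tendsto h
  simp only [sub_self, zero_smul, add_zero] at htendsto
  filter_upwards [htendsto.eventually (eventually_forall_inner_lt (s := {j | j ≠ i}) hlt)]
    with h' hh'
  refine ⟨_, ?_, hh'⟩
  rw [inner_add_right, real_inner_smul_right, hu, hp]
  ring

theorem IsIrredundant.exists_forall_inner_lt (hw : ∀ i, w i ≠ 0) (hirr : IsIrredundant w h) :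
    ∃ p, ∀ i, inner ℝ (w i) p < h i := by
  rcases isEmpty_or_nonempty ι with hι | ⟨⟨i⟩⟩
  · exact ⟨0, isEmptyElim⟩
  obtain ⟨p, hp, hlt⟩ := hirr i
  have hcont : Continuous fun t : ℝ => (h, p - t • w i) := by fun_prop
  have htendsto := hcont.tendsto 0
  rw [zero_smul, sub_zero] at htendsto
  have hnear : ∀ᶠ t : ℝ in 𝓝 0, ∀ j ≠ i, inner ℝ (w j) (p - t • w i) < h j :=
    htendsto.eventually (eventually_forall_inner_lt (s := {j | j ≠ i}) hlt)
  obtain ⟨t, ht, hothers⟩ := hnear.exists_gt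
  refine ⟨p - t • w i, fun j => ?_⟩
  rcases eq_or_ne j i with rfl | hj
  · rw [inner_sub_right, real_inner_smul_right, hp, sub_lt_self_iff]
    exact mul_pos ht (real_inner_self_pos.2 (hw j))
  · exact hothers j hj

theorem exists_eventually_closedBall_subset_polyhedron {p : E} (hp : ∀ i, inner ℝ (w i) p < h i) :
    ∃ r > 0, ∀ᶠ h' in 𝓝 h, closedBall p r ⊆ polyhedron w h' := by
  obtain ⟨V, hV, B, hB, hVB⟩ := mem_nhds_prod_iff.1
    (eventually_forall_inner_lt (s := Set.univ) fun i _ => hp i)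
  obtain ⟨r, hr, hrB⟩ := nhds_basis_closedBall.mem_iff.1 hB
  refine ⟨r, hr, ?_⟩
  filter_upwards [hV] with h' hh' x hx i
  exact (hVB (Set.mk_mem_prod hh' (hrB hx)) i trivial).le

theorem exists_eventually_polyhedron_subset_closedBall
    (hbdd : ∀ h, Bornology.IsBounded (polyhedron w h)) (h : ι → ℝ) :
    ∃ R, ∀ᶠ h' in 𝓝 h, polyhedron w h' ⊆ closedBall 0 R := by
  have := Fintype.ofFinite ι
  obtain ⟨R, hR⟩ := (hbdd (h + 1)).subset_closedBall 0
  refine ⟨R, ?_⟩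
  filter_upwards [closedBall_mem_nhds h one_pos] with h' hh'
  refine (polyhedron_mono fun i => ?_).trans hR
  exact (le_add_dist_apply h h' i).trans
    (add_le_add_right ((dist_comm h h').trans_le (mem_closedBall.1 hh')) _)

theorem exists_fatHeights_mem_nhds {n : ℕ} {w : ι → Pt n} (hw : ∀ i, w i ≠ 0)
    (hbdd : ∀ h, Bornology.IsBounded (polyhedron w h)) (hirr : IsIrredundant w h) :
    ∃ r > 0, ∃ R, fatHeights w r R ∈ 𝓝 h := by
  obtain ⟨p, hp⟩ := hirr.exists_forall_inner_lt hw
  obtain ⟨r, hr, hball⟩ := exists_eventually_closedBall_subset_polyhedron hp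
  obtain ⟨R, hR⟩ := exists_eventually_polyhedron_subset_closedBall hbdd h
  refine ⟨r, hr, R, ?_⟩
  filter_upwards [hball, hR] with h' hh' hh'R using ⟨⟨p, hh'⟩, hh'R⟩

end Finite

variable [Fintype ι]

theorem eventually_active_subset {x : E} (hx : x ∈ polyhedron w h) :
    ∀ᶠ z : (ι → ℝ) × E in 𝓝 (h, x), active w z.1 z.2 ⊆ active w h x := by
  filter_upwards [eventually_forall_inner_lt (s := {j | j ∉ active w h x}) fun j hj =>
    (hx j).lt_of_ne (mt mem_active.2 hj)] with z hz j hj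
  by_contra hjx
  exact (hz j hjx).ne (mem_active.1 hj)

theorem IsSmooth.eventually {n : ℕ} {v : ι → Fin n → ℤ}
    (hbdd : ∀ h, Bornology.IsBounded (polyhedron (fun i => intPt (v i)) h)) (hs : IsSmooth v h) :
    ∀ᶠ h' in 𝓝 h, IsSmooth v h' := by
  obtain ⟨R, hR⟩ := exists_eventually_polyhedron_subset_closedBall hbdd h
  have hdual : ∀ᶠ h' in 𝓝 h, ∀ x ∈ closedBall (0 : Pt n) R,
      x ∈ polyhedron (fun i => intPt (v i)) h' → ∃ u : ι → Fin n → ℤ,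
        IsDualOn (fun i => intPt (v i)) (fun i => intPt (u i))
          (active (fun i => intPt (v i)) h' x) := by
    refine (isCompact_closedBall _ _).eventually_forall_of_forall_eventually fun x _ => ?_
    by_cases hx : x ∈ polyhedron (fun i => intPt (v i)) h
    · obtain ⟨u, hu⟩ := hs x hx
      filter_upwards [eventually_active_subset hx] with z hz _
      exact ⟨u, hu.mono (Finset.coe_subset.2 hz)⟩
    · filter_upwards [eventually_notMem_polyhedron hx] with z hz hmem
      exact absurd hmem hz
  filter_upwards [hdual, hR] with h' hh' hh'R x hx
  exact hh' x (hh'R hx) hx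

end Stability

/-! ### The action of `AGL(n, ℤ)` -/

section Quotient

variable {n : ℕ}

theorem exists_finite_edist_smul_lt (P : ProperBody n) :
    ∃ η > 0, {g : AGLZ n | edist P (g • P) < η}.Finite := by
  obtain ⟨c, hc⟩ := P.interior_nonempty
  obtain ⟨r, hr, hrP⟩ := nhds_basis_closedBall.mem_iff.1 (mem_interior_iff_mem_nhds.1 hc)
  obtain ⟨R, hR⟩ := P.body.isCompact.isBounded.subset_closedBall 0
  refine ⟨volume (ball (0 : Pt n) (r / 4)), measure_ball_pos _ _ (by positivity), ?_⟩
  refine ((AGLZ.finite_mapsTo c (half_pos hr) R).preimage (inv_injective.injOn)).subset ?_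
  rintro g hg _ ⟨x, hx, rfl⟩
  obtain ⟨q, hq, rfl⟩ := AGLZ.ball_subset_of_edist_lt hr hrP hg hx
  exact ((g : Pt n ≃ᵃ[ℝ] Pt n).symm_apply_apply q).symm ▸ hR hq

theorem finite_stabilizer (P : ProperBody n) : Finite (MulAction.stabilizer (AGLZ n) P) := by
  obtain ⟨η, hη, hfin⟩ := exists_finite_edist_smul_lt P
  refine (hfin.subset fun g (hg : g • P = P) => ?_).to_subtype
  rwa [Set.mem_ofPred_eq, hg, edist_self]

theorem exists_mem_stabilizer_of_edist_lt (P : ProperBody n) :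
    ∃ η > 0, ∀ g : AGLZ n, edist P (g • P) < η → g ∈ MulAction.stabilizer (AGLZ n) P := by
  obtain ⟨η, hη, hfin⟩ := exists_finite_edist_smul_lt P
  have hfinite : {g : AGLZ n | edist P (g • P) < η ∧ g • P ≠ P}.Finite :=
    hfin.subset fun g hg => hg.1
  have hsmall : ∀ᶠ ε in 𝓝[>] (0 : ℝ≥0∞), ∀ g ∈ {g : AGLZ n | edist P (g • P) < η ∧ g • P ≠ P},
      ε < edist P (g • P) := hfinite.eventually_all.2 fun g hg =>
    nhdsWithin_le_nhds (eventually_lt_nhds (edist_pos.2 hg.2.symm))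
  obtain ⟨ε, hε, hεη⟩ := (hsmall.and (Ioo_mem_nhdsGT hη)).exists
  refine ⟨ε, hεη.1, fun g hg => ?_⟩
  by_contra hgP
  exact (hε g ⟨hg.trans hεη.2, hgP⟩).not_gt hg

theorem exists_mem_stabilizer_of_edist_lt_of_edist_lt (P : ProperBody n) :
    ∃ δ > 0, ∀ Q Q', edist P Q < δ → edist P Q' < δ → ∀ g : AGLZ n, edist Q (g • Q') < δ →
      g ∈ MulAction.stabilizer (AGLZ n) P := by
  obtain ⟨η, hη, hstab⟩ := exists_mem_stabilizer_of_edist_lt P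
  refine ⟨η / 3, ENNReal.div_pos hη.ne' (by simp), fun Q Q' hQ hQ' g hg => hstab g ?_⟩
  calc edist P (g • P)
      ≤ edist P Q + edist Q (g • Q') + edist (g • Q') (g • P) := edist_triangle4 _ _ _ _
    _ < η / 3 + η / 3 + η / 3 := by
        rw [AGLZ.edist_smul, edist_comm Q' P]
        exact ENNReal.add_lt_add (ENNReal.add_lt_add hQ hg) hQ'
    _ = η := ENNReal.add_thirds η

theorem edist_mk_eq_of_forall_smul_eq {Q Q' : ProperBody n} {δ : ℝ≥0∞} (hlt : edist Q Q' < δ)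
    (hfix : ∀ g : AGLZ n, edist Q (g • Q') < δ → g • Q' = Q') :
    edist (BodyOrbits.mk Q) (BodyOrbits.mk Q') = edist Q Q' := by
  refine (BodyOrbits.edist_mk_le _ _).antisymm (le_of_forall_gt fun ε hε => ?_)
  obtain ⟨R, hR, hlt'⟩ := BodyOrbits.exists_edist_lt
    (lt_min hε ((BodyOrbits.edist_mk_le _ _).trans_lt hlt))
  obtain ⟨g, rfl⟩ := BodyOrbits.mk_eq_mk.1 hR
  rw [hfix g (hlt'.trans_le (min_le_right _ _))] at hlt'
  exact hlt'.trans_le (min_le_left _ _)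

/- The stabilizer can only shrink under small perturbations; where its order is minimal it is
locally constant, and nearby bodies cannot be brought closer to each other by the action. -/
theorem exists_eventually_edist_mk_eq {X : Type*} [TopologicalSpace X] {W : Set X}
    (hW : IsOpen W) (hne : W.Nonempty) {f : X → ProperBody n} (hf : ContinuousOn f W) :
    ∃ x ∈ W, ∀ᶠ q : X × X in 𝓝 (x, x),
      edist (BodyOrbits.mk (f q.1)) (BodyOrbits.mk (f q.2)) = edist (f q.1) (f q.2) := by
  obtain ⟨x, hx, hmin⟩ := exists_minimalFor_of_wellFoundedLT (· ∈ W)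
    (fun x => Nat.card (MulAction.stabilizer (AGLZ n) (f x))) hne
  obtain ⟨δ, hδ, hstab⟩ := exists_mem_stabilizer_of_edist_lt_of_edist_lt (f x)
  have hnear : ∀ᶠ y in 𝓝 x, y ∈ W ∧ edist (f x) (f y) < δ / 2 := by
    refine (eventually_mem_set.2 (hW.mem_nhds hx)).and ?_
    filter_upwards [(hf.continuousAt (hW.mem_nhds hx)).eventually
      (Metric.eball_mem_nhds (f x) (ENNReal.half_pos hδ.ne'))] with y hy
    rwa [edist_comm]
  refine ⟨x, hx, ?_⟩
  filter_upwards [hnear.prod_nhds hnear] with q hqq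
  obtain ⟨⟨-, hq⟩, hqW, hq'⟩ := hqq
  have hlt := hq.trans_le ENNReal.half_le_self
  have hlt' := hq'.trans_le ENNReal.half_le_self
  have hclose : edist (f q.1) (f q.2) < δ := (edist_triangle_left _ _ (f x)).trans_lt
    ((ENNReal.add_lt_add hq hq').trans_eq (ENNReal.add_halves δ))
  have hstab_eq : MulAction.stabilizer (AGLZ n) (f q.2) = MulAction.stabilizer (AGLZ n) (f x) := by
    have := finite_stabilizer (f x)
    have hle : MulAction.stabilizer (AGLZ n) (f q.2) ≤ MulAction.stabilizer (AGLZ n) (f x) :=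
      fun g (hg : g • f q.2 = f q.2) => hstab _ _ hlt' hlt' g (by rwa [hg, edist_self])
    exact Subgroup.eq_of_le_of_card_ge hle ((le_total _ _).elim id (hmin hqW))
  exact edist_mk_eq_of_forall_smul_eq hclose fun g hg =>
    hstab_eq.symm.le (hstab _ _ hlt hlt' g hg)

end Quotient

/-! ### Lower bounds for the Hausdorff dimension -/

theorem dimH_le_dimH_image_of_forall_edist_le {X Y : Type*} [EMetricSpace X] [EMetricSpace Y]
    {K : ℝ≥0} {f : X → Y} {s : Set X} (hf : ∀ x ∈ s, ∀ y ∈ s, edist x y ≤ K * edist (f x) (f y)) :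
    dimH s ≤ dimH (f '' s) := by
  have hanti : AntilipschitzWith K fun x : s => f x := fun x y => hf x x.2 y y.2
  calc dimH s = dimH (Set.univ : Set s) := by
        rw [← Isometry.dimH_image (f := ((↑) : s → X)) isometry_subtype_coe, Set.image_univ,
          Subtype.range_coe]
    _ ≤ dimH ((fun x : s => f x) '' Set.univ) := hanti.le_dimH_image _
    _ = dimH (f '' s) := by rw [Set.image_univ, ← Set.image_eq_range]

theorem finrank_le_dimH_image_of_eventually {V Y : Type*} [NormedAddCommGroup V]
    [NormedSpace ℝ V] [FiniteDimensional ℝ V] [EMetricSpace Y] {f : V → Y} {s : Set V} {x : V}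
    {K : ℝ≥0} (hs : s ∈ 𝓝 x)
    (hf : ∀ᶠ q : V × V in 𝓝 (x, x), edist q.1 q.2 ≤ K * edist (f q.1) (f q.2)) :
    (finrank ℝ V : ℝ≥0∞) ≤ dimH (f '' s) := by
  rw [nhds_prod_eq, eventually_prod_self_iff'] at hf
  obtain ⟨t, ht, hft⟩ := hf
  calc (finrank ℝ V : ℝ≥0∞) = dimH (t ∩ s) := (Real.dimH_of_mem_nhds (inter_mem ht hs)).symm
    _ ≤ dimH (f '' (t ∩ s)) :=
      dimH_le_dimH_image_of_forall_edist_le fun y hy z hz => hft y hy.1 z hz.1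
    _ ≤ dimH (f '' s) := dimH_mono (Set.image_mono Set.inter_subset_right)

section LowerDim

variable {n : ℕ} {ι : Type*} [Fintype ι] {v : ι → Fin n → ℤ} {h : ι → ℝ}

/-- The right-hand sides for which the inequalities with integer normals `v` define a Delzant
polytope, each of them a facet. -/
def delzantHeights (v : ι → Fin n → ℤ) : Set (ι → ℝ) :=
  {h | IsSmooth v h ∧ IsIrredundant (fun i => intPt (v i)) h}

theorem intPt_ne_zero_of_mem_delzantHeights (hh : h ∈ delzantHeights v) (i : ι) :
    intPt (v i) ≠ 0 :=
  hh.1.isSimple.ne_zero hh.2 i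

theorem isOpen_delzantHeights
    (hbdd : ∀ h, Bornology.IsBounded (polyhedron (fun i => intPt (v i)) h)) :
    IsOpen (delzantHeights v) :=
  isOpen_iff_mem_nhds.2 fun _ hh => (hh.1.eventually hbdd).and
    (hh.2.eventually (intPt_ne_zero_of_mem_delzantHeights hh))

theorem exists_fatHeights_mem_nhds_of_mem_delzantHeights
    (hbdd : ∀ h, Bornology.IsBounded (polyhedron (fun i => intPt (v i)) h))
    (hh : h ∈ delzantHeights v) :
    ∃ r > 0, ∃ R, fatHeights (fun i => intPt (v i)) r R ∈ 𝓝 h :=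
  exists_fatHeights_mem_nhds (intPt_ne_zero_of_mem_delzantHeights hh) hbdd hh.2

theorem eventually_toSet_polytope
    (hbdd : ∀ h, Bornology.IsBounded (polyhedron (fun i => intPt (v i)) h))
    (hh : h ∈ delzantHeights v) :
    ∀ᶠ h' in 𝓝 h, (polytope (fun i => intPt (v i)) h').toSet =
      polyhedron (fun i => intPt (v i)) h' := by
  obtain ⟨r, hr, R, hnhds⟩ := exists_fatHeights_mem_nhds_of_mem_delzantHeights hbdd hh
  filter_upwards [hnhds] with h' hh' using toSet_polytope_of_mem_fatHeights hr hh'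

theorem continuousOn_polytope_delzantHeights
    (hbdd : ∀ h, Bornology.IsBounded (polyhedron (fun i => intPt (v i)) h)) :
    ContinuousOn (polytope fun i => intPt (v i)) (delzantHeights v) := fun h hh => by
  obtain ⟨r, hr, R, hnhds⟩ := exists_fatHeights_mem_nhds_of_mem_delzantHeights hbdd hh
  obtain ⟨K, hK⟩ := exists_lipschitzOnWith_polytope (R := R) hr fun i =>
    one_le_norm_intPt (intPt_ne_zero_of_mem_delzantHeights hh i)
  exact (hK.continuousOn.continuousAt hnhds).continuousWithinAt

theorem polytope_mem_delzantFacetsV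
    (hbdd : ∀ h, Bornology.IsBounded (polyhedron (fun i => intPt (v i)) h))
    (hh : h ∈ delzantHeights v) :
    polytope (fun i => intPt (v i)) h ∈ delzantFacetsV n (Fintype.card ι) := by
  have htoSet := (eventually_toSet_polytope hbdd hh).self_of_nhds
  have hint : (interior (polyhedron (fun i => intPt (v i)) h)).Nonempty :=
    htoSet ▸ (polytope (fun i => intPt (v i)) h).interior_nonempty
  rw [delzantFacetsV, Set.mem_ofPred_eq, htoSet]
  exact ⟨hh.1.isDelzant (hbdd h) hint, hasFacets_polyhedron hh.1.isSimple hh.2 (hbdd h) hint⟩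

theorem card_le_dimH_delzantFacetsH
    (hbdd : ∀ h, Bornology.IsBounded (polyhedron (fun i => intPt (v i)) h))
    (hne : (delzantHeights v).Nonempty) :
    (Fintype.card ι : ℝ≥0∞) ≤ dimH (delzantFacetsH n (Fintype.card ι)) := by
  obtain ⟨h, hh⟩ := hne
  have hopen := isOpen_delzantHeights hbdd
  obtain ⟨C, hC⟩ := exists_eventually_edist_le_mul_edist_body_polytope
    ((hopen.eventually_mem hh).mono fun _ hh' => hh'.2) (eventually_toSet_polytope hbdd hh)
  rw [← finrank_fintype_fun_eq_card ℝ, delzantFacetsH_eq_image]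
  refine (finrank_le_dimH_image_of_eventually (f := fun h =>
    (polytope (fun i => intPt (v i)) h).body) (hopen.mem_nhds hh) hC).trans (dimH_mono ?_)
  rintro _ ⟨h', hh', rfl⟩
  rw [finrank_fintype_fun_eq_card]
  exact Set.mem_image_of_mem _ (polytope_mem_delzantFacetsV hbdd hh')

theorem card_le_dimH_delzantFacetsQuot
    (hbdd : ∀ h, Bornology.IsBounded (polyhedron (fun i => intPt (v i)) h))
    (hne : (delzantHeights v).Nonempty) :
    (Fintype.card ι : ℝ≥0∞) ≤ dimH (delzantFacetsQuot n (Fintype.card ι)) := by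
  have hopen := isOpen_delzantHeights hbdd
  obtain ⟨h, hh, hmk⟩ := exists_eventually_edist_mk_eq hopen hne
    (continuousOn_polytope_delzantHeights hbdd)
  obtain ⟨C, hC⟩ := exists_eventually_edist_le_mul_edist_polytope
    (intPt_ne_zero_of_mem_delzantHeights hh) hh.2 (eventually_toSet_polytope hbdd hh)
  rw [← finrank_fintype_fun_eq_card ℝ]
  refine (finrank_le_dimH_image_of_eventually (f := fun h =>
    BodyOrbits.mk (polytope (fun i => intPt (v i)) h)) (hopen.mem_nhds hh)
    ((hC.and hmk).mono fun q hq => hq.1.trans_eq (by rw [hq.2]))).trans (dimH_mono ?_)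
  rintro _ ⟨h', hh', rfl⟩
  rw [finrank_fintype_fun_eq_card]
  exact Set.mem_image_of_mem _ (polytope_mem_delzantFacetsV hbdd hh')

end LowerDim

/-! ### Truncated simplices -/

theorem exists_isDualOn_sumElim_neg_single {n : ℕ} {β : Type*} {a q : β → Fin n → ℤ}
    {I : Finset (Fin n ⊕ β)}
    (hq : IsDualOn (fun i => intPt (a i)) (fun i => intPt (q i)) {i | Sum.inr i ∈ I})
    (hq₀ : ∀ i, Sum.inr i ∈ I → ∀ j, Sum.inl j ∈ I → q i j = 0) :
    ∃ u : Fin n ⊕ β → Fin n → ℤ,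
      IsDualOn (fun i => intPt (Sum.elim (fun j => -Pi.single j 1) a i)) (fun i => intPt (u i))
        I := by
  obtain ⟨hone, hzero⟩ := isDualOn_intPt_iff.1 hq
  set t : Fin n → Fin n → ℤ := fun j => ∑ i ∈ I.toRight, a i j • q i
  have ht : ∀ j, ∀ l, Sum.inl l ∈ I → t j l = 0 := fun j l hl => by
    refine (Finset.sum_apply _ _ _).trans (Finset.sum_eq_zero fun i hi => ?_)
    rw [Pi.smul_apply, hq₀ i (Finset.mem_toRight.1 hi) l hl, smul_zero]
  have hta : ∀ j, ∀ i, Sum.inr i ∈ I → t j ⬝ᵥ a i = a i j := fun j i hi => by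
    rw [sum_dotProduct, Finset.sum_eq_single_of_mem i (Finset.mem_toRight.2 hi), smul_dotProduct,
      hone i hi, smul_eq_mul, mul_one]
    intro l hl hli
    rw [smul_dotProduct, hzero l (Finset.mem_toRight.1 hl) i hi hli, smul_zero]
  refine ⟨Sum.elim (fun j => t j - Pi.single j 1) q, isDualOn_intPt_iff.2 ⟨?_, ?_⟩⟩
  · rintro (j | i) hi
    · simp [ht j j hi]
    · exact hone i hi
  · rintro (j | i) hi (l | l) hl hne
    · simp [ht j l hl, Pi.single_eq_of_ne (fun h => hne (congrArg Sum.inl h.symm) : l ≠ j)]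
    · simp [sub_dotProduct, hta j l hl]
    · simp [hq₀ i hi l hl]
    · exact hzero i hi l hl fun h => hne (congrArg Sum.inr h)

section Family

variable {k J : ℕ}

/-- The normal `(1, 1 - i, …, 1 - i)` of the `i`-th upper constraint of the truncated simplex. -/
def truncUpperNormal (k i : ℕ) : Fin (k + 2) → ℤ := Fin.cons 1 fun _ => 1 - (i : ℤ)

/-- The normals of the truncated simplex, which is the simplex `0 ≤ x j`, `x₀ + s ≤ truncBound J 0`
with `s = x₁ + ⋯ + x_{k+1}`, cut by the half-spaces `x₀ + (1 - i) s ≤ truncBound J i`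
for `1 ≤ i ≤ J`. -/
def truncNormal (k J : ℕ) : Fin (k + 2) ⊕ Fin (J + 1) → Fin (k + 2) → ℤ :=
  Sum.elim (fun j => -Pi.single j 1) fun i => truncUpperNormal k i

/-- The right-hand sides of the upper constraints of the truncated simplex. The bounds for `i` and
`i + 1` meet at `s = J - i`, so that the upper boundary has its breaks at `s = 1, …, J`. -/
noncomputable def truncBound (J i : ℕ) : ℝ := 1 + ((J : ℝ) - i) * ((J : ℝ) - i + 1) / 2

/-- The right-hand sides of the truncated simplex. -/
noncomputable def truncHeight (k J : ℕ) : Fin (k + 2) ⊕ Fin (J + 1) → ℝ :=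
  Sum.elim (fun _ => 0) fun i => truncBound J i

theorem inner_truncNormal_inl (j : Fin (k + 2)) (x : Pt (k + 2)) :
    inner ℝ (intPt (truncNormal k J (Sum.inl j))) x = -x j := by
  rw [inner_intPt]
  simp [truncNormal, Pi.single_apply]

theorem inner_truncNormal_inr (i : Fin (J + 1)) (x : Pt (k + 2)) :
    inner ℝ (intPt (truncNormal k J (Sum.inr i))) x =
      x 0 + (1 - (i : ℝ)) * ∑ j : Fin (k + 1), x j.succ := by
  rw [inner_intPt, Fin.sum_univ_succ]
  simp [truncNormal, truncUpperNormal, Finset.mul_sum]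

theorem isBounded_polyhedron_truncNormal (h : Fin (k + 2) ⊕ Fin (J + 1) → ℝ) :
    Bornology.IsBounded (polyhedron (fun i => intPt (truncNormal k J i)) h) := by
  refine ((PiLp.antilipschitzWith_ofLp 2 (fun _ : Fin (k + 2) => ℝ)).isBounded_preimage
    (isBounded_Icc (fun j => -h (Sum.inl j))
      fun j => h (Sum.inr 0) + ∑ l ∈ Finset.univ.erase j, h (Sum.inl l))).subset fun x hx => ?_
  have hlower : ∀ j, -h (Sum.inl j) ≤ x j := fun j => by
    have := hx (Sum.inl j)
    rw [inner_truncNormal_inl] at this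
    linarith
  have hsum : ∑ j, x j ≤ h (Sum.inr 0) := by
    have := hx (Sum.inr 0)
    rw [inner_truncNormal_inr] at this
    simpa [Fin.sum_univ_succ] using this
  refine ⟨hlower, fun j => ?_⟩
  have hothers : ∑ l ∈ Finset.univ.erase j, -h (Sum.inl l) ≤ ∑ l ∈ Finset.univ.erase j, x l :=
    Finset.sum_le_sum fun l _ => hlower l
  rw [Finset.sum_neg_distrib] at hothers
  rw [← Finset.add_sum_erase _ _ (Finset.mem_univ j)] at hsum
  change x j ≤ _
  linarith

theorem mem_polyhedron_truncNormal {x : Pt (k + 2)} :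
    x ∈ polyhedron (fun i => intPt (truncNormal k J i)) (truncHeight k J) ↔
      (∀ j, 0 ≤ x j) ∧ ∀ i : Fin (J + 1),
        x 0 + (1 - (i : ℝ)) * ∑ j : Fin (k + 1), x j.succ ≤ truncBound J i := by
  simp [polyhedron, inner_truncNormal_inl, inner_truncNormal_inr, truncHeight]

theorem one_le_truncBound {i : ℕ} (hi : i ≤ J) : 1 ≤ truncBound J i := by
  have hiJ : (0 : ℝ) ≤ (J : ℝ) - i := sub_nonneg.2 (Nat.cast_le.2 hi)
  have : 0 ≤ ((J : ℝ) - i) * ((J : ℝ) - i + 1) / 2 := by positivity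
  rw [truncBound]
  linarith

theorem eq_add_one_of_add_mul_eq_truncBound {i l : ℕ} {y s : ℝ} (hil : i < l)
    (hi : y + (1 - (i : ℝ)) * s = truncBound J i) (hl : y + (1 - (l : ℝ)) * s = truncBound J l)
    (hsucc : y + (1 - ((i + 1 : ℕ) : ℝ)) * s ≤ truncBound J (i + 1)) :
    l = i + 1 ∧ s = J - i := by
  have hil' : (i : ℝ) + 1 ≤ l := by exact_mod_cast hil
  simp only [truncBound] at hi hl hsucc
  push_cast at hsucc
  have : (J : ℝ) - i ≤ s := by nlinarith
  have hs : s = ((J : ℝ) - i + (J - l) + 1) / 2 :=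
    mul_left_cancel₀ (by linarith : (l : ℝ) - i ≠ 0) (by linear_combination hi - hl)
  have hli : (l : ℝ) = i + 1 := by linarith
  exact ⟨by exact_mod_cast hli, by rw [hs, hli]; ring⟩

theorem exists_forall_dotProduct_truncUpperNormal_eq {x : Pt (k + 2)} {j : Fin (k + 1)}
    (hx₀ : x 0 ≠ 0) (hj : x j.succ ≠ 0) :
    ∃ q : ℤ → ℤ → Fin (k + 2) → ℤ,
      (∀ α β (i : ℕ), q α β ⬝ᵥ truncUpperNormal k i = α + β * (1 - (i : ℤ))) ∧
        ∀ α β m, x m = 0 → q α β m = 0 := by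
  refine ⟨fun α β => α • Pi.single 0 1 + β • Pi.single j.succ 1, fun α β i => ?_,
    fun α β m hm => ?_⟩
  · simp only [truncUpperNormal, add_dotProduct, smul_dotProduct, single_one_dotProduct,
      Fin.cons_zero, Fin.cons_succ, smul_eq_mul, mul_one]
  · have hm₀ : m ≠ 0 := by rintro rfl; exact hx₀ hm
    have hmj : m ≠ j.succ := by rintro rfl; exact hj hm
    simp [hm₀, hmj]

theorem exists_dotProduct_truncUpperNormal_eq_one {x : Pt (k + 2)} {i : Fin (J + 1)}
    (hx : x ∈ polyhedron (fun i => intPt (truncNormal k J i)) (truncHeight k J))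
    (hi : x 0 + (1 - (i : ℝ)) * ∑ j : Fin (k + 1), x j.succ = truncBound J i) :
    ∃ q : Fin (k + 2) → ℤ, q ⬝ᵥ truncUpperNormal k i = 1 ∧ ∀ j, x j = 0 → q j = 0 := by
  by_cases hx₀ : x 0 = 0
  · have hs : 0 ≤ ∑ j : Fin (k + 1), x j.succ :=
      Finset.sum_nonneg fun j _ => (mem_polyhedron_truncNormal.1 hx).1 _
    have hbound := one_le_truncBound (J := J) (Nat.lt_succ_iff.1 i.2)
    rw [← hi, hx₀, zero_add] at hbound
    have hi₀ : (i : ℕ) = 0 := by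
      by_contra hne
      have : (1 : ℝ) ≤ i := by exact_mod_cast Nat.one_le_iff_ne_zero.2 hne
      nlinarith
    obtain ⟨j, -, hj⟩ := Finset.exists_ne_zero_of_sum_ne_zero
      (right_ne_zero_of_mul (zero_lt_one.trans_le hbound).ne')
    refine ⟨Pi.single j.succ 1, ?_, fun l hl => Pi.single_eq_of_ne (by rintro rfl; exact hj hl) _⟩
    simp [truncUpperNormal, hi₀]
  · refine ⟨Pi.single 0 1, ?_, fun l hl => Pi.single_eq_of_ne (by rintro rfl; exact hx₀ hl) _⟩
    simp [truncUpperNormal]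

section Upper

variable {x : Pt (k + 2)} {I : Set (Fin (J + 1))}

theorem eq_add_one_of_mem_of_lt
    (hx : x ∈ polyhedron (fun i => intPt (truncNormal k J i)) (truncHeight k J))
    (hI : ∀ i ∈ I, x 0 + (1 - (i : ℝ)) * ∑ j : Fin (k + 1), x j.succ = truncBound J i)
    {i l : Fin (J + 1)} (hi : i ∈ I) (hl : l ∈ I) (hil : i < l) :
    (l : ℕ) = i + 1 ∧ ∑ j : Fin (k + 1), x j.succ = J - i :=
  eq_add_one_of_add_mul_eq_truncBound hil (hI i hi) (hI l hl)
    ((mem_polyhedron_truncNormal.1 hx).2 ⟨i + 1, by omega⟩)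

theorem eq_or_eq_of_mem_of_lt
    (hx : x ∈ polyhedron (fun i => intPt (truncNormal k J i)) (truncHeight k J))
    (hI : ∀ i ∈ I, x 0 + (1 - (i : ℝ)) * ∑ j : Fin (k + 1), x j.succ = truncBound J i)
    {i l m : Fin (J + 1)} (hi : i ∈ I) (hl : l ∈ I) (hm : m ∈ I) (hil : i < l) :
    m = i ∨ m = l := by
  have hli := (eq_add_one_of_mem_of_lt hx hI hi hl hil).1
  rcases lt_trichotomy m i with hmi | rfl | him
  · have := (eq_add_one_of_mem_of_lt hx hI hm hi hmi).1
    have := (eq_add_one_of_mem_of_lt hx hI hm hl (hmi.trans hil)).1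
    omega
  · exact Or.inl rfl
  · have := (eq_add_one_of_mem_of_lt hx hI hi hm him).1
    exact Or.inr (Fin.ext (by omega))

theorem exists_isDualOn_truncUpperNormal_of_lt
    (hx : x ∈ polyhedron (fun i => intPt (truncNormal k J i)) (truncHeight k J))
    (hI : ∀ i ∈ I, x 0 + (1 - (i : ℝ)) * ∑ j : Fin (k + 1), x j.succ = truncBound J i)
    {i l : Fin (J + 1)} (hi : i ∈ I) (hl : l ∈ I) (hil : i < l) :
    ∃ q : Fin (J + 1) → Fin (k + 2) → ℤ, IsDualOn (fun i : Fin (J + 1) =>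
      intPt (truncUpperNormal k i)) (fun i => intPt (q i)) I ∧
        ∀ i ∈ I, ∀ j, x j = 0 → q i j = 0 := by
  obtain ⟨hli, hs⟩ := eq_add_one_of_mem_of_lt hx hI hi hl hil
  have hJ : (i : ℝ) + 1 ≤ J := by exact_mod_cast (by omega : (i : ℕ) + 1 ≤ J)
  obtain ⟨j, -, hj⟩ : ∃ j ∈ Finset.univ, x (Fin.succ j) ≠ 0 :=
    Finset.exists_ne_zero_of_sum_ne_zero (by rw [hs]; linarith)
  have hx₀ : x 0 ≠ 0 := fun hx₀ => by
    have htight := hI i hi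
    rw [hx₀, hs, truncBound] at htight
    nlinarith [mul_nonneg (Nat.cast_nonneg (α := ℝ) (i : ℕ)) (by linarith : (0 : ℝ) ≤ J - i)]
  have hli' : (l : ℤ) = i + 1 := by exact_mod_cast hli
  obtain ⟨q, hq, hq₀⟩ := exists_forall_dotProduct_truncUpperNormal_eq hx₀ hj
  refine ⟨fun m => if m = i then q i 1 else q (1 - i) (-1),
    isDualOn_intPt_iff.2 ⟨fun m hm => ?_, fun m hm m' hm' hne => ?_⟩, fun m _ m' hm' => ?_⟩
  · rcases eq_or_eq_of_mem_of_lt hx hI hi hl hm hil with rfl | rfl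
    · simp [hq]
    · simp [hq, hil.ne', hli']
  · rcases eq_or_eq_of_mem_of_lt hx hI hi hl hm hil with rfl | rfl <;>
      rcases eq_or_eq_of_mem_of_lt hx hI hi hl hm' hil with rfl | rfl
    · exact absurd rfl hne
    · simp [hq, hli']
    · simp [hq, hil.ne']
    · exact absurd rfl hne
  · dsimp only
    split_ifs <;> exact hq₀ _ _ m' hm'

theorem exists_isDualOn_truncUpperNormal
    (hx : x ∈ polyhedron (fun i => intPt (truncNormal k J i)) (truncHeight k J))
    (hI : ∀ i ∈ I, x 0 + (1 - (i : ℝ)) * ∑ j : Fin (k + 1), x j.succ = truncBound J i) :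
    ∃ q : Fin (J + 1) → Fin (k + 2) → ℤ, IsDualOn (fun i : Fin (J + 1) =>
      intPt (truncUpperNormal k i)) (fun i => intPt (q i)) I ∧
        ∀ i ∈ I, ∀ j, x j = 0 → q i j = 0 := by
  by_cases hpair : ∃ i ∈ I, ∃ l ∈ I, i < l
  · obtain ⟨i, hi, l, hl, hil⟩ := hpair
    exact exists_isDualOn_truncUpperNormal_of_lt hx hI hi hl hil
  · have hsub : I.Subsingleton := Set.not_nontrivial_iff.1 (mt Set.Nontrivial.exists_lt hpair)
    choose! q hone hzero using fun i hi => exists_dotProduct_truncUpperNormal_eq_one hx (hI i hi)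
    exact ⟨q, isDualOn_intPt_iff.2 ⟨hone, fun i hi l hl hne => absurd (hsub hi hl) hne⟩, hzero⟩

end Upper

theorem isSmooth_truncHeight (k J : ℕ) : IsSmooth (truncNormal k J) (truncHeight k J) := by
  intro x hx
  have htight : ∀ i : Fin (J + 1),
      Sum.inr i ∈ active (fun i => intPt (truncNormal k J i)) (truncHeight k J) x →
        x 0 + (1 - (i : ℝ)) * ∑ j : Fin (k + 1), x j.succ = truncBound J i := fun i hi => by
    simpa [inner_truncNormal_inr, truncHeight] using mem_active.1 hi
  obtain ⟨q, hq, hq₀⟩ := exists_isDualOn_truncUpperNormal hx htight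
  refine exists_isDualOn_sumElim_neg_single hq fun i hi j hj => hq₀ i hi j ?_
  simpa [inner_truncNormal_inl, truncHeight] using mem_active.1 hj

theorem exists_forall_inner_lt_truncHeight_of_inl (j : Fin (k + 2)) :
    ∃ p, inner ℝ (intPt (truncNormal k J (Sum.inl j))) p = truncHeight k J (Sum.inl j) ∧
      ∀ l, l ≠ Sum.inl j → inner ℝ (intPt (truncNormal k J l)) p < truncHeight k J l := by
  set δ : ℝ := 1 / ((k : ℝ) + 3) with hδ
  have hδ₀ : 0 < δ := by positivity
  have hδ₁ : ((k : ℝ) + 3) * δ = 1 := by rw [hδ]; field_simp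
  set p : Pt (k + 2) := WithLp.toLp 2 fun l => if l = j then 0 else δ
  have hp : ∀ l, p l = if l = j then 0 else δ := fun _ => rfl
  have hp_nonneg : ∀ l, 0 ≤ p l := fun l => by rw [hp]; split_ifs <;> linarith
  have hp_le : ∀ l, p l ≤ δ := fun l => by rw [hp]; split_ifs <;> linarith
  refine ⟨p, by simp [inner_truncNormal_inl, hp, truncHeight], ?_⟩
  rintro (l | i) hl
  · have hlj : l ≠ j := fun h => hl (by rw [h])
    simpa [inner_truncNormal_inl, hp, hlj, truncHeight] using hδ₀
  · rw [inner_truncNormal_inr]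
    refine lt_of_lt_of_le ?_ (one_le_truncBound (J := J) (Nat.lt_succ_iff.1 i.2))
    have hsum_le : ∑ l : Fin (k + 1), p l.succ ≤ ((k : ℝ) + 1) * δ :=
      (Finset.sum_le_card_nsmul _ _ δ fun l _ => hp_le _).trans_eq (by simp)
    have hsum_nonneg : 0 ≤ ∑ l : Fin (k + 1), p l.succ :=
      Finset.sum_nonneg fun l _ => hp_nonneg _
    nlinarith [hp_le 0, mul_nonneg (Nat.cast_nonneg (α := ℝ) (i : ℕ)) hsum_nonneg]

theorem exists_forall_inner_lt_truncHeight_of_inr (i : Fin (J + 1)) :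
    ∃ p, inner ℝ (intPt (truncNormal k J (Sum.inr i))) p = truncHeight k J (Sum.inr i) ∧
      ∀ l, l ≠ Sum.inr i → inner ℝ (intPt (truncNormal k J l)) p < truncHeight k J l := by
  have hi₀ : (0 : ℝ) ≤ i := Nat.cast_nonneg _
  have hiJ : (i : ℝ) ≤ J := Nat.cast_le.2 (Nat.lt_succ_iff.1 i.2)
  set σ : ℝ := (J : ℝ) - i + 1 / 2 with hσ
  have hσ₀ : 0 < σ := by linarith
  set y : ℝ := truncBound J i + ((i : ℝ) - 1) * σ with hy
  have hy₀ : 0 < y := by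
    rw [hy, truncBound, hσ]
    nlinarith [mul_nonneg hi₀ (sub_nonneg.2 hiJ), sq_nonneg ((J : ℝ) - i - 1 / 2)]
  have hgap : ∀ l : ℕ, truncBound J l - (y + (1 - (l : ℝ)) * σ) = ((l : ℝ) - i) ^ 2 / 2 := by
    intro l
    rw [hy, truncBound, truncBound, hσ]
    ring
  set p : Pt (k + 2) := WithLp.toLp 2 (Fin.cons y fun _ => σ / ((k : ℝ) + 1))
  have hsum : ∑ l : Fin (k + 1), p l.succ = σ := by
    change ∑ _ : Fin (k + 1), σ / ((k : ℝ) + 1) = σ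
    simp only [Finset.sum_const, Finset.card_univ, Fintype.card_fin, nsmul_eq_mul]
    push_cast
    field_simp
  have hupper : ∀ l : Fin (J + 1), inner ℝ (intPt (truncNormal k J (Sum.inr l))) p =
      y + (1 - (l : ℝ)) * σ := fun l => by rw [inner_truncNormal_inr, hsum]; rfl
  refine ⟨p, ?_, ?_⟩
  · rw [hupper]
    exact (sub_eq_zero.1 ((hgap i).trans (by simp))).symm
  · rintro (l | l) hl
    · rw [inner_truncNormal_inl, truncHeight, Sum.elim_inl, neg_lt_zero]
      exact Fin.cases hy₀ (fun _ => div_pos hσ₀ k.cast_add_one_pos) l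
    · have hne : (l : ℝ) ≠ i := fun h => hl (congrArg Sum.inr (Fin.ext (Nat.cast_injective h)))
      rw [hupper, truncHeight, Sum.elim_inr, ← sub_pos, hgap]
      exact half_pos (sq_pos_of_ne_zero (sub_ne_zero.2 hne))

theorem isIrredundant_truncHeight (k J : ℕ) :
    IsIrredundant (fun i => intPt (truncNormal k J i)) (truncHeight k J)
  | Sum.inl j => exists_forall_inner_lt_truncHeight_of_inl j
  | Sum.inr i => exists_forall_inner_lt_truncHeight_of_inr i

end Family

theorem natCast_le_dimH_delzantFacetsH_and_delzantFacetsQuot {n m : ℕ} (hn : 2 ≤ n)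
    (hm : n + 1 ≤ m) :
    (m : ℝ≥0∞) ≤ dimH (delzantFacetsH n m) ∧ (m : ℝ≥0∞) ≤ dimH (delzantFacetsQuot n m) := by
  obtain ⟨k, rfl⟩ := Nat.exists_eq_add_of_le' hn
  obtain ⟨J, rfl⟩ := Nat.exists_eq_add_of_le hm
  have hne : (delzantHeights (truncNormal k J)).Nonempty :=
    ⟨truncHeight k J, isSmooth_truncHeight k J, isIrredundant_truncHeight k J⟩
  have hcard : Fintype.card (Fin (k + 2) ⊕ Fin (J + 1)) = k + 2 + 1 + J := by
    rw [Fintype.card_sum, Fintype.card_fin, Fintype.card_fin]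
    ring
  rw [← hcard]
  exact ⟨card_le_dimH_delzantFacetsH isBounded_polyhedron_truncNormal hne,
    card_le_dimH_delzantFacetsQuot isBounded_polyhedron_truncNormal hne⟩

theorem dimH_delzantFacets_eq {n m : ℕ} (hn : 2 ≤ n) (hm : n + 1 ≤ m) :
    dimH (delzantFacetsH n m) = m ∧ dimH (delzantFacetsV n m) = m ∧
      dimH (delzantFacetsQuot n m) = m := by
  obtain ⟨hH, hQuot⟩ := natCast_le_dimH_delzantFacetsH_and_delzantFacetsQuot hn hm
  exact ⟨dimH_delzantFacetsH_le.antisymm hH,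
    dimH_delzantFacetsV_le.antisymm (hQuot.trans dimH_delzantFacetsQuot_le),
    (dimH_delzantFacetsQuot_le.trans dimH_delzantFacetsV_le).antisymm hQuot⟩

theorem eq_top_of_forall_natCast_le {a : ℝ≥0∞} (N : ℕ)
    (h : ∀ m : ℕ, N ≤ m → (m : ℝ≥0∞) ≤ a) : a = ⊤ :=
  top_le_iff.1 (le_of_tendsto ENNReal.tendsto_nat_nhds_top (eventually_atTop.2 ⟨N, h⟩))

end Delzant

theorem mainTheorem7 (n : ℕ) (hn : 2 ≤ n) :
    (∀ m : ℕ, n + 1 ≤ m →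
      dimH (Delzant.delzantFacetsH n m) = m ∧
      dimH (Delzant.delzantFacetsV n m) = m ∧
      dimH (Delzant.delzantFacetsQuot n m) = m) ∧
    dimH (Delzant.delzantH n) = ⊤ ∧
    dimH (Delzant.delzantV n) = ⊤ ∧
    dimH (Delzant.delzantQuot n) = ⊤ := by
  have hdim := fun m (hm : n + 1 ≤ m) => Delzant.dimH_delzantFacets_eq hn hm
  refine ⟨hdim, ?_, ?_, ?_⟩ <;> refine Delzant.eq_top_of_forall_natCast_le (n + 1) fun m hm => ?_
  · exact (hdim m hm).1.ge.trans (dimH_mono fun _ hP => hP.1)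
  · exact (hdim m hm).2.1.ge.trans (dimH_mono fun _ hP => hP.1)
  · exact (hdim m hm).2.2.ge.trans (dimH_mono (Set.image_mono fun _ hP => hP.1))
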